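/- For a nondegenerate triangle $ABC$ in the Euclidean plane with $a=BC$, $b=CA$, $c=AB$, let $X_n$ ($1\le n\le 10$) be the triangle center with homogeneous barycentric coordinates $(f_n(a,b,c):f_n(b,c,a):f_n(c,a,b))$, where $f_1=a$, $f_2=1$, $f_3=a^2(a^2-b^2-c^2)$, $f_4=(a^2+b^2-c^2)(a^2-b^2+c^2)$, $f_5=c^4-a^2b^2+b^4-a^2c^2-2b^2c^2$, $f_6=a^2$, $f_7=(a+b-c)(a-b+c)$, $f_8=a-b-c$, $f_9=a(a-b-c)$, $f_{10}=b+c$ (incenter, centroid, circumcenter, orthocenter, nine-point center, symmedian point, Gergonne point, Nagel point, mittenpunkt, Spieker center). Let $D(i,j)$ be the distance between $X_i$ and $X_j$. An inequality $k\le D(7,i)/D(7,j)$ or $D(7,i)/D(7,j)\le k$ is understood as $k\,D(7,j)\le D(7,i)$ or $D(7,i)\le k\,D(7,j)$, respectively, so that it makes sense also when $D(7,j)=0$. **Theorem.** The following bounds hold for all triangles: $$\tfrac{D(7,1)}{D(7,2)}\le\tfrac34,\quad \tfrac{D(7,1)}{D(7,3)}\le\tfrac{2}{17}(5-2\sqrt2),\quad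 \tfrac{D(7,1)}{D(7,4)}\le1,\quad \tfrac{D(7,1)}{D(7,8)}\le\tfrac12,\quad \tfrac{D(7,1)}{D(7,9)}\le\tfrac12,\quad \tfrac{D(7,1)}{D(7,10)}\le\tfrac23,$$ $$\tfrac{D(7,2)}{D(7,3)}\le\tfrac23,\quad 2\le\tfrac{D(7,2)}{D(7,6)},\quad \tfrac13\le\tfrac{D(7,2)}{D(7,8)}\le\tfrac23,\quad \tfrac{D(7,2)}{D(7,9)}=\tfrac23,\quad \tfrac23\le\tfrac{D(7,2)}{D(7,10)}\le\tfrac89,$$ $$\tfrac12\le\tfrac{D(7,3)}{D(7,4)},\quad 2\le\tfrac{D(7,3)}{D(7,5)},\quad C_7\le\tfrac{D(7,3)}{D(7,6)},\quad \tfrac12\le\tfrac{D(7,3)}{D(7,8)},\quad 1\le\tfrac{D(7,3)}{D(7,9)},\quad 1\le\tfrac{D(7,3)}{D(7,10)},$$ $$1\le\tfrac{D(7,4)}{D(7,6)},\quad \tfrac{D(7,6)}{D(7,8)}\le\tfrac13,\quad \tfrac{D(7,6)}{D(7,9)}\le\tfrac13,\quad \tfrac{D(7,6)}{D(7,10)}\le\tfrac49,$$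 $$1\le\tfrac{D(7,8)}{D(7,9)}\le2,\quad \tfrac43\le\tfrac{D(7,8)}{D(7,10)}\le2,\quad 1\le\tfrac{D(7,9)}{D(7,10)}\le\tfrac43,$$ where $C_7\approx 7.9776615835$ (correct to ten decimal places) is the largest real root of $$\begin{aligned}&833089536x^{28}+220028016384x^{26}-19474287964848x^{24}+139707882692901x^{22}-410390834384412x^{20}\\&+732430210466916x^{18}-892396597211316x^{16}+782711166381062x^{14}-492062343977916x^{12}+216425700787620x^{10}\\&-65960002546284x^{8}+14226627485565x^{6}-2259294716376x^{4}+253570773456x^{2}-14637417984.\end{aligned}$$ All these constants are best possible: no lower bound can be replaced by a larger constant and no upper bound by a smaller one. For all $i<j$ in $\{1,\dots,10\}\setminus\{7\}$, wherever no lower bound for $D(7,i)/D(7,j)$ is listed, the best lower bound is $0$, and wherever no upper bound is listed, there is no finite constant $k$ with $D(7,i)\le k\,D(7,j)$ for all triangles. -/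

import Mathlib

open Polynomial

/-- A nondegenerate triangle in the Euclidean plane. -/
abbrev PlaneTriangle : Type := Affine.Triangle ℝ (EuclideanSpace ℝ (Fin 2))

/-- The first barycentric coordinate `f(a,b,c)` of the triangle center `X_n`, `1 ≤ n ≤ 10`, as a
function of the side lengths: `X_1` incenter, `X_2` centroid, `X_3` circumcenter,
`X_4` orthocenter, `X_5` nine-point center, `X_6` symmedian point, `X_7` Gergonne point,
`X_8` Nagel point, `X_9` mittenpunkt, `X_10` Spieker center. Other indices are not used. -/
def centerWeight (n : ℕ) (a b c : ℝ) : ℝ :=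
  match n with
  | 1 => a
  | 2 => 1
  | 3 => a ^ 2 * (a ^ 2 - b ^ 2 - c ^ 2)
  | 4 => (a ^ 2 + b ^ 2 - c ^ 2) * (a ^ 2 - b ^ 2 + c ^ 2)
  | 5 => c ^ 4 - a ^ 2 * b ^ 2 + b ^ 4 - a ^ 2 * c ^ 2 - 2 * b ^ 2 * c ^ 2
  | 6 => a ^ 2
  | 7 => (a + b - c) * (a - b + c)
  | 8 => a - b - c
  | 9 => a * (a - b - c)
  | 10 => b + c
  | _ => 0

/-- The point with homogeneous barycentric coordinates `(u : v : w)` with respect to `t`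
(meaningful for `u + v + w ≠ 0`). -/
noncomputable def barycentricPoint (t : PlaneTriangle) (u v w : ℝ) : EuclideanSpace ℝ (Fin 2) :=
  (u + v + w)⁻¹ • (u • t.points 0 + v • t.points 1 + w • t.points 2)

/-- The triangle center `X_n = (f(a,b,c) : f(b,c,a) : f(c,a,b))` of the triangle `t = ABC`,
with `a = BC`, `b = CA`, `c = AB`. -/
noncomputable def triangleCenter (t : PlaneTriangle) (n : ℕ) : EuclideanSpace ℝ (Fin 2) :=
  let a := dist (t.points 1) (t.points 2)
  let b := dist (t.points 2) (t.points 0)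
  let c := dist (t.points 0) (t.points 1)
  barycentricPoint t (centerWeight n a b c) (centerWeight n b c a) (centerWeight n c a b)

/-- `D(i,j)`: the distance between `X_i` and `X_j` in the triangle `t`. -/
noncomputable def centerDist (t : PlaneTriangle) (i j : ℕ) : ℝ :=
  dist (triangleCenter t i) (triangleCenter t j)

/-- `k` is the best (largest) constant with `k ≤ D(n,i) / D(n,j)` for all triangles. As the
denominator may vanish, the inequality is read as `k * D(n,j) ≤ D(n,i)`. -/
def IsBestLowerBound (n i j : ℕ) (k : ℝ) : Prop :=
  IsGreatest {q : ℝ | ∀ t : PlaneTriangle, q * centerDist t n j ≤ centerDist t n i} k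

/-- `k` is the best (smallest) constant with `D(n,i) / D(n,j) ≤ k` for all triangles, the
inequality being read as `D(n,i) ≤ k * D(n,j)`. -/
def IsBestUpperBound (n i j : ℕ) (k : ℝ) : Prop :=
  IsLeast {q : ℝ | ∀ t : PlaneTriangle, centerDist t n i ≤ q * centerDist t n j} k

/-- `lo ≤ D(n,i) / D(n,j) ≤ hi` for all triangles, and both constants are best possible. -/
def BestBounds (n i j : ℕ) (lo hi : ℝ) : Prop :=
  IsBestLowerBound n i j lo ∧ IsBestUpperBound n i j hi

/-- `lo ≤ D(n,i) / D(n,j)` for all triangles with `lo` best possible, and no finite constant is an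
upper bound of the ratio for all triangles. -/
def BestBoundsTop (n i j : ℕ) (lo : ℝ) : Prop :=
  IsBestLowerBound n i j lo ∧
    ¬ ∃ q : ℝ, ∀ t : PlaneTriangle, centerDist t n i ≤ q * centerDist t n j

/-- The polynomial of degree 28 whose largest real root is `C_7`. -/
noncomputable def polyC7 : ℝ[X] :=
  833089536 * X ^ 28 + 220028016384 * X ^ 26 - 19474287964848 * X ^ 24
    + 139707882692901 * X ^ 22 - 410390834384412 * X ^ 20 + 732430210466916 * X ^ 18
    - 892396597211316 * X ^ 16 + 782711166381062 * X ^ 14 - 492062343977916 * X ^ 12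
    + 216425700787620 * X ^ 10 - 65960002546284 * X ^ 8 + 14226627485565 * X ^ 6
    - 2259294716376 * X ^ 4 + 253570773456 * X ^ 2 - 14637417984

/-! Write the sides as sums of the tangent lengths `x, y, z` (Ravi substitution). Every squared
distance from the Gergonne point is symmetric in `x, y, z`, so up to a common positive factor it is
a function `gergonneSq n w u` of two scale-free parameters (`IsTangentLengths.centerDist_sq`). The
admissible pairs are governed by Blundon's inequality, which is the nonnegativity of the
discriminant of the cubic with roots `x, y, z`; equality means that the triangle is isosceles.

For `n ≠ 6` the function `gergonneSq n w u` is affine in `u`. At fixed `w`, Blundon's inequality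
confines `u` to an interval whose two ends come from isosceles triangles, so a comparison of two
such distances holds for all triangles once it holds for isosceles ones
(`linear_nonneg_of_isosceles`). There all centers lie on the axis, the distances lose their square
roots, and what remains is a polynomial inequality in one variable `t`. Sharpness and unboundedness
are read off on the same family, usually in the degenerate limits `t = 0` and `t = 1/2`.

The symmedian point is not affine in `u`. Against the mittenpunkt it is bounded by completing a
square, against the orthocenter by first majorizing it by an affine function of `u`; its other
bounds, except the one against the circumcenter, follow by chaining. For the pair (1, 6) the ratio
tends to `0` only along scalene degenerations.

The pair (3, 6) has a scalene optimum. The largest `k` for which `ratioPoly k` is nonnegative on all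
triangles exists, and by compactness `ratioPoly k` attains the value zero at some triangle. This
triangle is not isosceles, because isosceles triangles satisfy `8 D(7,6) ≤ D(7,3)` while `k < 64`.
Hence it is an interior point of the parameter domain, both partial derivatives vanish there, and
elimination (`elimination_certificate`) makes `k` a root of `sextPoly`. As `sextPoly` has at most
one root beyond `9`, this identifies `√k` with the largest root of `polyC7`. -/

/-- For a triangle with inradius `ρ`, `w = (xy + yz + zx) / ρ²` and
`u = (x + y + z)² / (xy + yz + zx)` (with `x, y, z` the tangent lengths), the squared distance
from the Gergonne point to `X_n` is `ρ² / w` times `gergonneSq n w u`. -/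
noncomputable def gergonneSq (n : ℕ) (w u : ℝ) : ℝ :=
  match n with
  | 1 => w - 3 * u
  | 2 => (u * (w ^ 2 + 6 * w - 27) - 4 * w ^ 2) / 9
  | 3 => (w * (w - 1) ^ 2 - 16 * u * (w + 3)) / 16
  | 4 => (w - 1) * (w * (w - 1) - 4 * u * (w - 3)) / 4
  | 5 => (w * (w ^ 2 - 34 * w + 1) + 96 * u * (w - 2)) / 64
  | 6 => ((w + 3) ^ 2 * (u - 1) - 12 * (u - 1) ^ 3 - 3 * (w - 1) ^ 2) / (4 * (u - 1) ^ 2)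
  | 8 => (w - 1) * (u * (w + 3) - 4 * w)
  | 9 => (u * (w ^ 2 + 6 * w - 27) - 4 * w ^ 2) / 4
  | 10 => (u * (w ^ 2 + 4 * w - 12) - 4 * w ^ 2 + w) / 4
  | _ => 0

/-! ### Squared distances in terms of tangent lengths -/

/-- A combination with weights of sum zero is a displacement: eliminating `d` writes it through `B -
A` and `C - A`, and polarization turns the inner product into squared sides. -/
theorem dist_sq_affine_combination {V : Type*} [NormedAddCommGroup V] [InnerProductSpace ℝ V]
    (A B C : V) {d e f : ℝ} (h : d + e + f = 0) :
    ‖d • A + e • B + f • C‖ ^ 2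
      = -(dist B C ^ 2 * (e * f) + dist C A ^ 2 * (f * d) + dist A B ^ 2 * (d * e)) := by
  have hd : d • A + e • B + f • C = e • (B - A) + f • (C - A) := by
    have : d = -e - f := by linarith
    subst this
    module
  have hBC : dist B C ^ 2 = ‖(B - A) - (C - A)‖ ^ 2 := by
    rw [dist_eq_norm]; congr 2; abel
  have hCA : dist C A ^ 2 = ‖C - A‖ ^ 2 := by rw [dist_eq_norm]
  have hAB : dist A B ^ 2 = ‖B - A‖ ^ 2 := by rw [dist_comm, dist_eq_norm]
  rw [hd, hBC, hCA, hAB, norm_add_sq_real, norm_sub_sq_real, norm_smul, norm_smul, mul_pow,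
    mul_pow, real_inner_smul_left, real_inner_smul_right, Real.norm_eq_abs, Real.norm_eq_abs,
    sq_abs, sq_abs]
  have : d = -e - f := by linarith
  subst this
  ring

theorem dist_sq_barycentricPoint (t : PlaneTriangle) {u v w u' v' w' : ℝ} (h : u + v + w ≠ 0)
    (h' : u' + v' + w' ≠ 0) :
    dist (barycentricPoint t u v w) (barycentricPoint t u' v' w') ^ 2
      = -(dist (t.points 1) (t.points 2) ^ 2
          * ((v / (u + v + w) - v' / (u' + v' + w')) * (w / (u + v + w) - w' / (u' + v' + w')))
        + dist (t.points 2) (t.points 0) ^ 2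
          * ((w / (u + v + w) - w' / (u' + v' + w')) * (u / (u + v + w) - u' / (u' + v' + w')))
        + dist (t.points 0) (t.points 1) ^ 2
          * ((u / (u + v + w) - u' / (u' + v' + w'))
            * (v / (u + v + w) - v' / (u' + v' + w')))) := by
  rw [← dist_sq_affine_combination, dist_eq_norm]
  · congr 2
    simp only [barycentricPoint, div_eq_inv_mul]
    module
  · have e1 : u / (u + v + w) + v / (u + v + w) + w / (u + v + w) = 1 := by
      field_simp
    have e2 : u' / (u' + v' + w') + v' / (u' + v' + w') + w' / (u' + v' + w') = 1 := by
      field_simp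
    linarith

/-- The lengths `x, y, z` of the tangents from the vertices of `t` to its incircle. -/
structure IsTangentLengths (t : PlaneTriangle) (x y z : ℝ) : Prop where
  x_pos : 0 < x
  y_pos : 0 < y
  z_pos : 0 < z
  dist_BC : dist (t.points 1) (t.points 2) = y + z
  dist_CA : dist (t.points 2) (t.points 0) = z + x
  dist_AB : dist (t.points 0) (t.points 1) = x + y

theorem dist_lt_of_not_collinear {V : Type*} [NormedAddCommGroup V] [NormedSpace ℝ V]
    [StrictConvexSpace ℝ V] {A B C : V} (h : ¬ Collinear ℝ {A, B, C}) :
    dist A C < dist A B + dist B C := by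
  refine lt_of_le_of_ne (dist_triangle A B C) fun h' => h ?_
  exact (dist_add_dist_eq_iff.1 h'.symm).collinear

/-- The strict triangle inequalities are exactly the positivity of `(b + c - a) / 2` and its cyclic
variants. -/
theorem exists_isTangentLengths (t : PlaneTriangle) :
    ∃ x y z : ℝ, IsTangentLengths t x y z := by
  have hi := t.independent
  have h1 : ¬ Collinear ℝ {t.points 0, t.points 1, t.points 2} := by
    rw [← affineIndependent_iff_not_collinear_set]
    have : ![t.points 0, t.points 1, t.points 2] = t.points := by
      funext i; fin_cases i <;> rfl
    rwa [this]
  have h2 : ¬ Collinear ℝ {t.points 1, t.points 2, t.points 0} := by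
    rwa [show ({t.points 1, t.points 2, t.points 0} : Set (EuclideanSpace ℝ (Fin 2)))
      = {t.points 0, t.points 1, t.points 2} by ext; simp; tauto]
  have h3 : ¬ Collinear ℝ {t.points 2, t.points 0, t.points 1} := by
    rwa [show ({t.points 2, t.points 0, t.points 1} : Set (EuclideanSpace ℝ (Fin 2)))
      = {t.points 0, t.points 1, t.points 2} by ext; simp; tauto]
  have k1 := dist_lt_of_not_collinear h1
  have k2 := dist_lt_of_not_collinear h2
  have k3 := dist_lt_of_not_collinear h3
  rw [dist_comm (t.points 0) (t.points 2)] at k1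
  rw [dist_comm (t.points 1) (t.points 0)] at k2
  rw [dist_comm (t.points 2) (t.points 1)] at k3
  set a := dist (t.points 1) (t.points 2)
  set b := dist (t.points 2) (t.points 0)
  set c := dist (t.points 0) (t.points 1)
  exact ⟨(b + c - a) / 2, (c + a - b) / 2, (a + b - c) / 2, by linarith, by linarith,
    by linarith, by ring, by ring, by ring⟩

theorem exists_triangle {x y z : ℝ} (hx : 0 < x) (hy : 0 < y) (hz : 0 < z) :
    ∃ t : PlaneTriangle, IsTangentLengths t x y z := by
  -- With `A` at the origin and `B` on the first axis, `m` is the abscissa of `C` given by the law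
  -- of cosines and `h` its height, twice the Heron area over `AB`.
  set m : ℝ := (x * (x + y + z) - y * z) / (x + y) with hm
  set h : ℝ := 2 * √(x * y * z * (x + y + z)) / (x + y) with hh
  have hs : √(x * y * z * (x + y + z)) ^ 2 = x * y * z * (x + y + z) :=
    Real.sq_sqrt (by positivity)
  let A : EuclideanSpace ℝ (Fin 2) := !₂[0, 0]
  let B : EuclideanSpace ℝ (Fin 2) := !₂[x + y, 0]
  let C : EuclideanSpace ℝ (Fin 2) := !₂[m, h]
  have hxy : x + y ≠ 0 := by positivity
  have hh2 : h ^ 2 = 4 * (x * y * z * (x + y + z)) / (x + y) ^ 2 := by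
    rw [hh, div_pow, mul_pow, hs]; norm_num
  have dAB : dist A B = x + y := by
    rw [EuclideanSpace.dist_eq, Real.sqrt_eq_iff_mul_self_eq (by positivity) (by positivity)]
    simp [A, B, Fin.sum_univ_two, Real.dist_eq]
    ring
  have dBC : dist B C = y + z := by
    rw [EuclideanSpace.dist_eq, Real.sqrt_eq_iff_mul_self_eq (by positivity) (by positivity)]
    simp only [Fin.sum_univ_two, Real.dist_eq, sq_abs]
    simp [B, C]
    rw [hh2, hm]
    field_simp
    ring
  have dCA : dist C A = z + x := by
    rw [EuclideanSpace.dist_eq, Real.sqrt_eq_iff_mul_self_eq (by positivity) (by positivity)]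
    simp only [Fin.sum_univ_two, Real.dist_eq, sq_abs]
    simp [A, C]
    rw [hh2, hm]
    field_simp
    ring
  have hi : AffineIndependent ℝ ![A, B, C] := by
    rw [affineIndependent_iff_not_collinear_set]
    intro hc
    rcases hc.wbtw_or_wbtw_or_wbtw with h' | h' | h'
    all_goals
      have := h'.dist_add_dist
      simp only [dist_comm B A, dist_comm C B, dist_comm A C, dAB, dBC, dCA] at this
      linarith
  exact ⟨⟨![A, B, C], hi⟩, hx, hy, hz, dBC, dCA, dAB⟩

/-- Since `ρ² = xyz / (x + y + z)`, the prefactor is `ρ² / w`; it does not depend on `n`, so it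
cancels in every ratio. -/
theorem IsTangentLengths.centerDist_sq {t : PlaneTriangle} {x y z : ℝ}
    (h : IsTangentLengths t x y z) {n : ℕ} (hn : n ∈ Finset.Icc 1 10) :
    centerDist t 7 n ^ 2 = (x * y * z) ^ 2 / ((x + y + z) ^ 2 * (x * y + y * z + z * x))
      * gergonneSq n ((x + y + z) * (x * y + y * z + z * x) / (x * y * z))
          ((x + y + z) ^ 2 / (x * y + y * z + z * x)) := by
  obtain ⟨hx, hy, hz, ha, hb, hc⟩ := h
  have hp : 0 < x + y + z := by positivity
  have hq : 0 < x * y + y * z + z * x := by positivity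
  have hr : 0 < x * y * z := by positivity
  have hu : (x + y + z) ^ 2 / (x * y + y * z + z * x) - 1
      = (x ^ 2 + y ^ 2 + z ^ 2 + x * y + y * z + z * x) / (x * y + y * z + z * x) := by
    field_simp; ring
  have s7 : centerWeight 7 (y + z) (z + x) (x + y) + centerWeight 7 (z + x) (x + y) (y + z)
      + centerWeight 7 (x + y) (y + z) (z + x) = 4 * (x * y + y * z + z * x) := by
    simp only [centerWeight]; ring
  -- Here `s` is the total weight of `X_m`. Supplying it in factored form for each center makes it
  -- visibly nonzero and keeps the denominators small.
  have key : ∀ (m : ℕ) (s : ℝ), s ≠ 0 →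
      centerWeight m (y + z) (z + x) (x + y) + centerWeight m (z + x) (x + y) (y + z)
        + centerWeight m (x + y) (y + z) (z + x) = s →
      centerDist t 7 m ^ 2 =
      -((y + z) ^ 2
          * ((centerWeight 7 (z + x) (x + y) (y + z) / (4 * (x * y + y * z + z * x))
              - centerWeight m (z + x) (x + y) (y + z) / s)
            * (centerWeight 7 (x + y) (y + z) (z + x) / (4 * (x * y + y * z + z * x))
              - centerWeight m (x + y) (y + z) (z + x) / s))
        + (z + x) ^ 2
          * ((centerWeight 7 (x + y) (y + z) (z + x) / (4 * (x * y + y * z + z * x))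
              - centerWeight m (x + y) (y + z) (z + x) / s)
            * (centerWeight 7 (y + z) (z + x) (x + y) / (4 * (x * y + y * z + z * x))
              - centerWeight m (y + z) (z + x) (x + y) / s))
        + (x + y) ^ 2
          * ((centerWeight 7 (y + z) (z + x) (x + y) / (4 * (x * y + y * z + z * x))
              - centerWeight m (y + z) (z + x) (x + y) / s)
            * (centerWeight 7 (z + x) (x + y) (y + z) / (4 * (x * y + y * z + z * x))
              - centerWeight m (z + x) (x + y) (y + z) / s))) := by
    intro m s hs hsum
    have := dist_sq_barycentricPoint t (u := centerWeight 7 (y + z) (z + x) (x + y))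
      (v := centerWeight 7 (z + x) (x + y) (y + z)) (w := centerWeight 7 (x + y) (y + z) (z + x))
      (u' := centerWeight m (y + z) (z + x) (x + y))
      (v' := centerWeight m (z + x) (x + y) (y + z)) (w' := centerWeight m (x + y) (y + z) (z + x))
      (by rw [s7]; positivity) (by rw [hsum]; exact hs)
    rw [s7, hsum, ha, hb, hc] at this
    rw [← this, centerDist, triangleCenter, triangleCenter, ha, hb, hc]
  rw [Finset.mem_Icc] at hn
  obtain ⟨h1, h10⟩ := hn
  interval_cases n
  · rw [key 1 (2 * (x + y + z)) (by positivity) (by simp only [centerWeight]; ring)]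
    simp only [centerWeight, gergonneSq]
    field_simp
    ring
  · rw [key 2 3 (by positivity) (by simp only [centerWeight]; ring)]
    simp only [centerWeight, gergonneSq]
    field_simp
    ring
  · rw [key 3 (-16 * (x + y + z) * (x * y * z)) (by simp; exact ⟨hp.ne', ⟨hx.ne', hy.ne'⟩, hz.ne'⟩)
      (by simp only [centerWeight]; ring)]
    simp only [centerWeight, gergonneSq]
    field_simp
    ring
  · rw [key 4 (16 * (x + y + z) * (x * y * z)) (by positivity)
      (by simp only [centerWeight]; ring)]
    simp only [centerWeight, gergonneSq]
    field_simp
    ring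
  · rw [key 5 (-32 * (x + y + z) * (x * y * z)) (by simp; exact ⟨hp.ne', ⟨hx.ne', hy.ne'⟩, hz.ne'⟩)
      (by simp only [centerWeight]; ring)]
    simp only [centerWeight, gergonneSq]
    field_simp
    ring
  · rw [key 6 (2 * (x ^ 2 + y ^ 2 + z ^ 2 + x * y + y * z + z * x)) (by positivity)
      (by simp only [centerWeight]; ring)]
    simp only [centerWeight, gergonneSq, hu]
    field_simp
    ring
  · simp [centerDist, gergonneSq]
  · rw [key 8 (-(x + y + z) * 2) (by simp; linarith) (by simp only [centerWeight]; ring)]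
    simp only [centerWeight, gergonneSq]
    field_simp
    ring
  · rw [key 9 (-4 * (x * y + y * z + z * x)) (by simp; linarith)
      (by simp only [centerWeight]; ring)]
    simp only [centerWeight, gergonneSq]
    field_simp
    ring
  · rw [key 10 (4 * (x + y + z)) (by positivity) (by simp only [centerWeight]; ring)]
    simp only [centerWeight, gergonneSq]
    field_simp
    ring

/-! ### Blundon's inequality and the isosceles family -/

/-- The admissible pairs `(w, u)` of a triangle (Blundon's inequality). -/
structure IsTriangleParam (w u : ℝ) : Prop where
  nine_le : 9 ≤ w
  three_le : 3 ≤ u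
  blundon : 0 ≤ w ^ 2 * (u - 4) - 4 * w * u ^ 2 + 18 * w * u - 27 * u

/-- `(w, u)` are the parameters of a triangle with tangent lengths `x, y, z`. -/
def IsRealized (w u : ℝ) : Prop :=
  ∃ x y z : ℝ, 0 < x ∧ 0 < y ∧ 0 < z ∧
    w = (x + y + z) * (x * y + y * z + z * x) / (x * y * z) ∧
    u = (x + y + z) ^ 2 / (x * y + y * z + z * x)

/-- The left side is a rescaled discriminant of the cubic with roots `x, y, z`. Hence it vanishes
exactly when two tangent lengths agree. -/
theorem blundon_eq {x y z : ℝ} (hx : 0 < x) (hy : 0 < y) (hz : 0 < z) {w u : ℝ}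
    (hw : w = (x + y + z) * (x * y + y * z + z * x) / (x * y * z))
    (hu : u = (x + y + z) ^ 2 / (x * y + y * z + z * x)) :
    w ^ 2 * (u - 4) - 4 * w * u ^ 2 + 18 * w * u - 27 * u
      = (x + y + z) ^ 2 / ((x * y + y * z + z * x) * (x * y * z) ^ 2)
        * ((x - y) * (y - z) * (z - x)) ^ 2 := by
  have hq : 0 < x * y + y * z + z * x := by positivity
  rw [hw, hu]
  field_simp
  ring

theorem IsRealized.isTriangleParam {w u : ℝ} (h : IsRealized w u) : IsTriangleParam w u := by
  obtain ⟨x, y, z, hx, hy, hz, hw, hu⟩ := h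
  have hq : 0 < x * y + y * z + z * x := by positivity
  have hr : 0 < x * y * z := by positivity
  refine ⟨?_, ?_, ?_⟩
  · rw [hw, le_div_iff₀ hr]
    nlinarith [mul_nonneg hx.le (sq_nonneg (y - z)), mul_nonneg hy.le (sq_nonneg (z - x)),
      mul_nonneg hz.le (sq_nonneg (x - y))]
  · rw [hu, le_div_iff₀ hq]
    nlinarith [sq_nonneg (y - z), sq_nonneg (z - x), sq_nonneg (x - y)]
  · rw [blundon_eq hx hy hz hw hu]
    positivity

/-- The distances `D(7, n)` in the isosceles triangle with tangent lengths `t, t, 1 - 2 t`, up to a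
common factor. -/
noncomputable def isoDist (n : ℕ) (t : ℝ) : ℝ :=
  match n with
  | 1 => t * (1 - 2 * t)
  | 2 => 2 / 3 * (1 - 2 * t)
  | 3 => 1 - 3 / 2 * t - 1 / 2 * t ^ 2
  | 4 => t * (1 - t)
  | 5 => |1 / 2 - 5 / 4 * t + 1 / 4 * t ^ 2|
  | 6 => t * |1 - 3 * t| * (1 - 2 * t) / (1 - 2 * t + 3 * t ^ 2)
  | 8 => 2 * (1 - t) * (1 - 2 * t)
  | 9 => 1 - 2 * t
  | 10 => (1 - 1 / 2 * t) * (1 - 2 * t)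
  | _ => 0

theorem isoDist_denom_pos (t : ℝ) : 0 < 1 - 2 * t + 3 * t ^ 2 := by
  nlinarith [sq_nonneg (3 * t - 1)]

theorem isoDist_nonneg (n : ℕ) {t : ℝ} (h0 : 0 < t) (h1 : t < 1 / 2) : 0 ≤ isoDist n t := by
  have h2 : 0 < 1 - 2 * t := by linarith
  have h3 : 0 < 1 - t := by linarith
  have h4 : 0 < 1 - 1 / 2 * t := by linarith
  have h5 := isoDist_denom_pos t
  unfold isoDist
  split <;> first | positivity | nlinarith

/-- All centers lie on the axis of symmetry, so each squared distance is a perfect square up to a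
common factor. That factor vanishes at `t = 1 / 3`, the equilateral triangle, where all the centers
coincide. -/
theorem gergonneSq_isosceles {n : ℕ} (hn : n ∈ Finset.Icc 1 10) {t : ℝ} (h0 : 0 < t)
    (h1 : t < 1 / 2) :
    gergonneSq n ((2 - 3 * t) / (t * (1 - 2 * t))) (1 / (t * (2 - 3 * t)))
      = (1 - 3 * t) ^ 2 / (t ^ 3 * (1 - 2 * t) ^ 3 * (2 - 3 * t)) * isoDist n t ^ 2 := by
  have h2 : 0 < 1 - 2 * t := by linarith
  have h3 : 0 < 2 - 3 * t := by linarith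
  have h5 := isoDist_denom_pos t
  -- The denominators become opaque atoms so that they are cleared as factors; they are expanded
  -- again only for the final `ring`.
  obtain ⟨d, hd⟩ : ∃ d, d = 2 - 3 * t := ⟨_, rfl⟩
  obtain ⟨e, he⟩ : ∃ e, e = 1 - 2 * t := ⟨_, rfl⟩
  obtain ⟨g, hg⟩ : ∃ g, g = 1 - 2 * t + 3 * t ^ 2 := ⟨_, rfl⟩
  rw [← hg] at h5
  rw [← he] at h2
  rw [← hd] at h3
  by_cases hn6 : n = 6
  · subst hn6
    have hu : 1 / (t * d) - 1 = g / (t * d) := by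
      field_simp
      rw [hd, hg]
      ring
    simp only [gergonneSq, isoDist, ← hd, ← he, hu, div_pow, mul_pow, sq_abs]
    field_simp
    rw [hg, hd, he]
    ring
  rw [Finset.mem_Icc] at hn
  obtain ⟨ha, hb⟩ := hn
  interval_cases n
  all_goals first
    | contradiction
    | simp only [gergonneSq, isoDist, sq_abs, ← hd, ← he]
      field_simp
      rw [hd, he]
      ring

theorem exists_isosceles {t : ℝ} (h0 : 0 < t) (h1 : t < 1 / 2) :
    ∃ (T : PlaneTriangle) (c : ℝ), (t ≠ 1 / 3 → 0 < c) ∧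
      ∀ n ∈ Finset.Icc 1 10, centerDist T 7 n = c * isoDist n t := by
  have h2 : 0 < 1 - 2 * t := by linarith
  have h3 : 0 < 2 - 3 * t := by linarith
  obtain ⟨T, hT⟩ := exists_triangle h0 h0 h2
  refine ⟨T, √((1 - 3 * t) ^ 2 / ((2 - 3 * t) ^ 2 * (1 - 2 * t))),
    fun h => ?_, fun n hn => ?_⟩
  · have h4 : 1 - 3 * t ≠ 0 := fun h' => h (by linarith)
    positivity
  · have hs := hT.centerDist_sq hn
    obtain ⟨d, hd⟩ : ∃ d, d = 2 - 3 * t := ⟨_, rfl⟩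
    obtain ⟨e, he⟩ : ∃ e, e = 1 - 2 * t := ⟨_, rfl⟩
    have hp : t + t + e = 1 := by rw [he]; ring
    have hq : t * t + t * e + e * t = t * d := by rw [he, hd]; ring
    rw [← he] at h2 hs
    rw [← hd] at h3
    rw [hp, hq, show 1 * (t * d) / (t * t * e) = d / (t * e) by field_simp, one_pow, hd, he,
      gergonneSq_isosceles hn h0 h1, ← hd, ← he] at hs
    have hD : 0 ≤ centerDist T 7 n := dist_nonneg
    refine (sq_eq_sq₀ hD (mul_nonneg (Real.sqrt_nonneg _) (isoDist_nonneg n h0 h1))).1 ?_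
    rw [hs, ← hd, ← he, mul_pow √_, Real.sq_sqrt (by positivity)]
    field_simp

/-- At fixed `w`, Blundon's inequality is quadratic in `u` and places `u` between two roots, each
realized by an isosceles triangle with the same `w`. An affine function that is nonnegative at both
ends is nonnegative between them. -/
theorem linear_nonneg_of_isosceles {w u α β : ℝ} (h : IsTriangleParam w u)
    (H : ∀ t : ℝ, 0 < t → t < 1 / 2 → w = (2 - 3 * t) / (t * (1 - 2 * t)) →
      0 ≤ α + 1 / (t * (2 - 3 * t)) * β) : 0 ≤ α + u * β := by
  obtain ⟨hw, hu, hB⟩ := h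
  have hw0 : 0 < w := by linarith
  -- The isosceles triangles with parameter `w` solve `2 w t ^ 2 - (w + 3) t + 2 = 0`, whose
  -- discriminant is `(w - 1) (w - 9)`.
  obtain ⟨s, hs0, hs⟩ : ∃ s : ℝ, 0 ≤ s ∧ s ^ 2 = (w - 1) * (w - 9) :=
    ⟨√((w - 1) * (w - 9)), Real.sqrt_nonneg _, Real.sq_sqrt (by nlinarith)⟩
  have hs1 : s ≤ w - 5 := by
    refine (abs_le_of_sq_le_sq' ?_ (by linarith)).2
    nlinarith
  have root : ∀ σ : ℝ, σ ^ 2 = s ^ 2 → 0 < (w + 3 + σ) / (4 * w) → (w + 3 + σ) / (4 * w) < 1 / 2 →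
      w = (2 - 3 * ((w + 3 + σ) / (4 * w)))
        / ((w + 3 + σ) / (4 * w) * (1 - 2 * ((w + 3 + σ) / (4 * w)))) := by
    intro σ hσ h0 h1
    have h2 : 0 < (w + 3 + σ) / (4 * w) * (1 - 2 * ((w + 3 + σ) / (4 * w))) :=
      mul_pos h0 (by linarith)
    rw [eq_div_iff h2.ne']
    field_simp
    rw [hs] at hσ
    linear_combination (-2 : ℝ) * hσ
  have a1 : 0 < (w + 3 + s) / (4 * w) := by positivity
  have a2 : (w + 3 + s) / (4 * w) < 1 / 2 := by
    rw [div_lt_div_iff₀ (by positivity) (by norm_num)]; linarith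
  have b1 : 0 < (w + 3 + -s) / (4 * w) := div_pos (by linarith) (by positivity)
  have b2 : (w + 3 + -s) / (4 * w) < 1 / 2 := by
    rw [div_lt_div_iff₀ (by positivity) (by norm_num)]; linarith
  have H1 := H _ a1 a2 (root s rfl a1 a2)
  have H2 := H _ b1 b2 (root (-s) (by ring) b1 b2)
  set t₁ := (w + 3 + s) / (4 * w) with ht₁
  set t₂ := (w + 3 + -s) / (4 * w) with ht₂
  have sum : t₁ + t₂ = (w + 3) / (2 * w) := by rw [ht₁, ht₂]; field_simp; ring
  have prod : t₁ * t₂ = 1 / w := by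
    rw [ht₁, ht₂]; field_simp; linear_combination -hs
  have p1 : 0 < t₁ * (2 - 3 * t₁) := mul_pos a1 (by linarith)
  have p2 : 0 < t₂ * (2 - 3 * t₂) := mul_pos b1 (by linarith)
  have prod' : t₁ * (2 - 3 * t₁) * (t₂ * (2 - 3 * t₂)) = 1 / w := by
    have : t₁ * (2 - 3 * t₁) * (t₂ * (2 - 3 * t₂))
      = t₁ * t₂ * (4 - 6 * (t₁ + t₂) + 9 * (t₁ * t₂)) := by ring
    rw [this, sum, prod]; field_simp; ring
  have sum' : t₁ * (2 - 3 * t₁) + t₂ * (2 - 3 * t₂) = (w ^ 2 + 18 * w - 27) / (4 * w ^ 2) := by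
    have : t₁ * (2 - 3 * t₁) + t₂ * (2 - 3 * t₂)
      = 2 * (t₁ + t₂) - 3 * ((t₁ + t₂) ^ 2 - 2 * (t₁ * t₂)) := by ring
    rw [this, sum, prod]; field_simp; ring
  set A₁ := t₁ * (2 - 3 * t₁)
  set A₂ := t₂ * (2 - 3 * t₂)
  -- By Vieta, this product is the Blundon expression divided by `-4 w`.
  have key : (u - 1 / A₁) * (u - 1 / A₂) ≤ 0 := by
    have e : (u - 1 / A₁) * (u - 1 / A₂)
        = u ^ 2 - u * ((A₁ + A₂) / (A₁ * A₂)) + 1 / (A₁ * A₂) := by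
      field_simp; ring
    have e' : (A₁ + A₂) / (A₁ * A₂) = (w ^ 2 + 18 * w - 27) / (4 * w) := by
      rw [sum', prod']; field_simp
    have e'' : 1 / (A₁ * A₂) = w := by rw [prod']; field_simp
    rw [e, e', e'']
    have : u ^ 2 - u * ((w ^ 2 + 18 * w - 27) / (4 * w)) + w
        = -(w ^ 2 * (u - 4) - 4 * w * u ^ 2 + 18 * w * u - 27 * u) / (4 * w) := by
      field_simp; ring
    rw [this]
    exact div_nonpos_of_nonpos_of_nonneg (by linarith) (by positivity)
  generalize 1 / A₁ = u₁ at *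
  generalize 1 / A₂ = u₂ at *
  rcases mul_nonpos_iff.1 key with ⟨k1, k2⟩ | ⟨k1, k2⟩ <;> rcases le_total 0 β with hβ | hβ <;>
    nlinarith

/-- Being affine in `u` is what the isosceles reduction needs. For the symmedian point `u - 1`
occurs in a denominator, hence its separate treatment. -/
theorem gergonneSq_eq_linear {n : ℕ} (hn : n ≠ 6) (w u : ℝ) :
    gergonneSq n w u = gergonneSq n w 0 + u * (gergonneSq n w 1 - gergonneSq n w 0) := by
  unfold gergonneSq
  split <;> first | contradiction | ring

theorem mul_centerDist_le_of_gergonneSq {i j : ℕ} (hi : i ∈ Finset.Icc 1 10)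
    (hj : j ∈ Finset.Icc 1 10) {a b : ℝ} (hb : 0 ≤ b)
    (H : ∀ w u : ℝ, IsRealized w u → a ^ 2 * gergonneSq j w u ≤ b ^ 2 * gergonneSq i w u)
    (T : PlaneTriangle) : a * centerDist T 7 j ≤ b * centerDist T 7 i := by
  obtain ⟨x, y, z, hT⟩ := exists_isTangentLengths T
  have hx := hT.x_pos
  have hy := hT.y_pos
  have hz := hT.z_pos
  have hD : 0 ≤ centerDist T 7 i := dist_nonneg
  refine (abs_le_of_sq_le_sq' ?_ (mul_nonneg hb hD)).2
  rw [mul_pow, mul_pow, hT.centerDist_sq hi, hT.centerDist_sq hj, mul_left_comm,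
    mul_left_comm (b ^ 2)]
  exact mul_le_mul_of_nonneg_left (H _ _ ⟨x, y, z, hx, hy, hz, rfl, rfl⟩) (by positivity)

/-- Comparison of distances other than `D(7, 6)` reduces to isosceles triangles. -/
theorem mul_gergonneSq_le_of_isoDist {i j : ℕ} (hi : i ∈ Finset.Icc 1 10)
    (hj : j ∈ Finset.Icc 1 10) (hi6 : i ≠ 6) (hj6 : j ≠ 6) {a b : ℝ} (ha : 0 ≤ a)
    (H : ∀ t : ℝ, 0 < t → t < 1 / 2 → a * isoDist j t ≤ b * isoDist i t)
    {w u : ℝ} (h : IsTriangleParam w u) :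
    a ^ 2 * gergonneSq j w u ≤ b ^ 2 * gergonneSq i w u := by
  have := linear_nonneg_of_isosceles h
    (α := b ^ 2 * gergonneSq i w 0 - a ^ 2 * gergonneSq j w 0)
    (β := b ^ 2 * (gergonneSq i w 1 - gergonneSq i w 0)
      - a ^ 2 * (gergonneSq j w 1 - gergonneSq j w 0)) fun t h0 h1 hw => ?_
  · rw [gergonneSq_eq_linear hi6 w u, gergonneSq_eq_linear hj6 w u]
    linarith
  · have h2 : 0 < 1 - 2 * t := by linarith
    have h3 : 0 < 2 - 3 * t := by linarith
    have e1 := gergonneSq_isosceles hi h0 h1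
    have e2 := gergonneSq_isosceles hj h0 h1
    rw [← hw] at e1 e2
    rw [gergonneSq_eq_linear hi6] at e1
    rw [gergonneSq_eq_linear hj6] at e2
    have hsq : (a * isoDist j t) ^ 2 ≤ (b * isoDist i t) ^ 2 :=
      pow_le_pow_left₀ (mul_nonneg ha (isoDist_nonneg j h0 h1)) (H t h0 h1) 2
    have := mul_le_mul_of_nonneg_left hsq
      (show 0 ≤ (1 - 3 * t) ^ 2 / (t ^ 3 * (1 - 2 * t) ^ 3 * (2 - 3 * t)) by positivity)
    linear_combination this + a ^ 2 * e2 - b ^ 2 * e1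

theorem mul_centerDist_le_of_isoDist {i j : ℕ} (hi : i ∈ Finset.Icc 1 10)
    (hj : j ∈ Finset.Icc 1 10) (hi6 : i ≠ 6) (hj6 : j ≠ 6) {a b : ℝ} (ha : 0 ≤ a) (hb : 0 ≤ b)
    (H : ∀ t : ℝ, 0 < t → t < 1 / 2 → a * isoDist j t ≤ b * isoDist i t) (T : PlaneTriangle) :
    a * centerDist T 7 j ≤ b * centerDist T 7 i :=
  mul_centerDist_le_of_gergonneSq hi hj hb
    (fun _ _ h => mul_gergonneSq_le_of_isoDist hi hj hi6 hj6 ha H h.isTriangleParam) T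

/-- Density argument: it restores the equilateral parameter, where all distances vanish and nothing
can be inferred, and adds the two degenerate ends. -/
theorem le_on_Icc_of_le_on_Ioo {f g : ℝ → ℝ} (hf : Continuous f) (hg : Continuous g)
    (H : ∀ t : ℝ, 0 < t → t < 1 / 2 → t ≠ 1 / 3 → f t ≤ g t) {t : ℝ}
    (ht : t ∈ Set.Icc (0 : ℝ) (1 / 2)) : f t ≤ g t := by
  have hc : Set.Icc (0 : ℝ) (1 / 2) ⊆ closure (Set.Ioo 0 (1 / 2) ∩ {1 / 3}ᶜ) := by
    rw [← closure_Ioo (by norm_num)]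
    refine closure_minimal ?_ isClosed_closure
    exact (dense_compl_singleton (1 / 3 : ℝ)).open_subset_closure_inter isOpen_Ioo
  exact closure_minimal (fun s hs => H s hs.1.1 hs.1.2 hs.2) (isClosed_le hf hg) (hc ht)

/-- Necessary conditions for a constant: `m` collects a common positive factor, possibly vanishing
or singular in a degenerate limit. After cancelling it the inequality passes to the closed interval
by continuity. -/
theorem le_of_forall_mul_centerDist_le {i j : ℕ} (hi : i ∈ Finset.Icc 1 10)
    (hj : j ∈ Finset.Icc 1 10) {a b : ℝ} (H : ∀ T, a * centerDist T 7 j ≤ b * centerDist T 7 i)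
    (m : ℝ → ℝ) {f g : ℝ → ℝ} (hm : ∀ t : ℝ, 0 < t → t < 1 / 2 → 0 < m t)
    (hf : ∀ t : ℝ, 0 < t → t < 1 / 2 → isoDist i t = m t * f t)
    (hg : ∀ t : ℝ, 0 < t → t < 1 / 2 → isoDist j t = m t * g t)
    (hfc : Continuous f) (hgc : Continuous g) {t : ℝ} (ht : t ∈ Set.Icc (0 : ℝ) (1 / 2)) :
    a * g t ≤ b * f t := by
  refine le_on_Icc_of_le_on_Ioo (hgc.const_mul a) (hfc.const_mul b) (fun s h0 h1 h3 => ?_) ht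
  obtain ⟨T, c, hc, hT⟩ := exists_isosceles h0 h1
  have := H T
  rw [hT i hi, hT j hj, hf s h0 h1, hg s h0 h1] at this
  have hpos : 0 < c * m s := mul_pos (hc h3) (hm s h0 h1)
  refine le_of_mul_le_mul_left ?_ hpos
  linarith

/-! ### Bounds for the symmedian point -/

theorem nine_mul_gergonneSq_six_le {w u : ℝ} (h : IsTriangleParam w u) :
    9 * gergonneSq 6 w u ≤ gergonneSq 9 w u := by
  obtain ⟨hw, hu, -⟩ := h
  obtain ⟨τ, rfl⟩ : ∃ τ, u = τ + 1 := ⟨u - 1, by ring⟩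
  have hτ : 2 ≤ τ := by linarith
  simp only [gergonneSq, add_sub_cancel_right]
  rw [← sub_nonneg]
  -- The difference is quadratic in `w` with leading coefficient proportional to `(τ + 3) (τ - 3) ^
  -- 2`; completing the square leaves a remainder that is nonnegative for `τ ≥ 2`.
  have : 0 ≤ ((τ + 3) * (w * (τ - 3) + 3 * (τ + 1)) ^ 2 + 72 * τ * (τ + 1) * (τ - 2))
      / (4 * τ ^ 2) := by
    have : 0 ≤ τ - 2 := by linarith
    positivity
  refine this.trans_eq ?_
  field_simp
  ring

/-- The majorant is affine in `u`, so that the isosceles reduction becomes available. The term in `1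
/ τ` is replaced by its chord between the two isosceles ends, and the concave term in `-1 / τ ^ 2`
by a tangent. -/
theorem gergonneSq_six_le_linear {w u : ℝ} (h : IsTriangleParam w u) :
    gergonneSq 6 w u ≤ (w + 3) ^ 2 / 4 * ((w ^ 2 + 14 * w - 27 - 4 * w * u)
      / (3 * w ^ 2 - 14 * w + 27)) - 3 * (u - 1) - 36 + 96 * (u - 1) / (w - 1) := by
  obtain ⟨hw, hu, hB⟩ := h
  obtain ⟨τ, rfl⟩ : ∃ τ, u = τ + 1 := ⟨u - 1, by ring⟩
  have hτ : 0 < τ := by linarith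
  obtain ⟨v, rfl⟩ : ∃ v, w = v + 1 := ⟨w - 1, by ring⟩
  have hv : 0 < v := by linarith
  simp only [gergonneSq, add_sub_cancel_right]
  -- After clearing denominators this is Blundon's inequality itself.
  have h1 : 1 / τ ≤ ((v + 1) ^ 2 + 14 * (v + 1) - 27 - 4 * (v + 1) * (τ + 1))
      / (3 * (v + 1) ^ 2 - 14 * (v + 1) + 27) := by
    rw [div_le_div_iff₀ hτ (by nlinarith)]
    linarith
  -- Tangent line at `τ = v / 4`, which is the exact relation for the equilateral triangle (`v = 8`,
  -- `τ = 2`).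
  have h2 : 36 - 96 * τ / v ≤ 3 * v ^ 2 / (4 * τ ^ 2) := by
    rw [← sub_nonneg]
    have : 0 ≤ 3 * ((v - 4 * τ) ^ 2 * (v + 8 * τ)) / (4 * τ ^ 2 * v) := by positivity
    refine this.trans_eq ?_
    field_simp
    ring
  have h3 := mul_le_mul_of_nonneg_left h1 (show 0 ≤ (v + 1 + 3) ^ 2 / 4 by positivity)
  have h4 : ((v + 1 + 3) ^ 2 * τ - 12 * τ ^ 3 - 3 * v ^ 2) / (4 * τ ^ 2)
      = (v + 1 + 3) ^ 2 / 4 * (1 / τ) - 3 * τ - 3 * v ^ 2 / (4 * τ ^ 2) := by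
    field_simp
    ring
  rw [h4]
  linarith

theorem gergonneSq_six_le_four {w u : ℝ} (h : IsTriangleParam w u) :
    gergonneSq 6 w u ≤ gergonneSq 4 w u := by
  refine (gergonneSq_six_le_linear h).trans ?_
  -- `α` and `β` are the constant term and the slope in `u` of `gergonneSq 4` minus the affine
  -- majorant.
  have key := linear_nonneg_of_isosceles h
    (α := (w - 1) * (w * (w - 1)) / 4 - (w + 3) ^ 2 / 4 * ((w ^ 2 + 14 * w - 27)
      / (3 * w ^ 2 - 14 * w + 27)) - 3 + 36 + 96 / (w - 1))
    (β := -(w - 1) * (w - 3) + (w + 3) ^ 2 / 4 * (4 * w / (3 * w ^ 2 - 14 * w + 27)) + 3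
      - 96 / (w - 1)) fun t h0 h1 hw => ?_
  · rw [← sub_nonneg]
    refine key.trans_eq ?_
    simp only [gergonneSq]
    ring
  · obtain ⟨d, hd⟩ : ∃ d, d = 2 - 3 * t := ⟨_, rfl⟩
    obtain ⟨a, ha⟩ : ∃ a, a = 1 - 2 * t := ⟨_, rfl⟩
    obtain ⟨c, hc⟩ : ∃ c, c = 1 - t := ⟨_, rfl⟩
    obtain ⟨g, hg⟩ : ∃ g, g = 1 - 2 * t + 3 * t ^ 2 := ⟨_, rfl⟩
    obtain ⟨k, hk⟩ : ∃ k, k = 9 * t ^ 2 - 10 * t + 3 := ⟨_, rfl⟩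
    have hd0 : 0 < d := by linarith
    have ha0 : 0 < a := by linarith
    have hc0 : 0 < c := by linarith
    have hg0 : 0 < g := hg ▸ isoDist_denom_pos t
    have hk0 : 0 < k := by rw [hk]; nlinarith [sq_nonneg (9 * t - 5)]
    rw [← hd, ← ha] at hw
    rw [← hd]
    have e1 : w - 1 = 2 * c ^ 2 / (t * a) := by
      rw [hw]; field_simp; rw [hd, hc, ha]; ring
    have e2 : w + 3 = 2 * (1 - 3 * t ^ 2) / (t * a) := by
      rw [hw]; field_simp; rw [hd, ha]; ring
    have e3 : 3 * w ^ 2 - 14 * w + 27 = 4 * g * k / (t ^ 2 * a ^ 2) := by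
      rw [hw]; field_simp; rw [hd, ha, hg, hk]; ring
    have e4 : w ^ 2 + 14 * w - 27 - 4 * w * (1 / (t * d)) = 4 * d * k / (t * a ^ 2) := by
      rw [hw]; field_simp; rw [hd, ha, hk]; ring
    have e5 : 1 / (t * d) - 1 = g / (t * d) := by
      field_simp; rw [hd, hg]; ring
    have e6 : w * (w - 1) - 4 * (1 / (t * d)) * (w - 3)
        = 2 * (1 - 3 * t) ^ 2 / (a ^ 2 * d) := by
      rw [hw]; field_simp; rw [hd, ha]; ring
    -- Apart from the double zero at the equilateral triangle, the numerator is homogenized through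
    -- `a + 2 t = 1`; all its coefficients in `a` and `t` are then positive.
    have hpos : 0 ≤ (1 - 3 * t) ^ 2 * (256 * a ^ 6 + 1920 * t * a ^ 5 + 3712 * t ^ 2 * a ^ 4
        + 6912 * t ^ 3 * a ^ 3 + 3328 * t ^ 4 * a ^ 2 + 1920 * t ^ 5 * a + 384 * t ^ 6) / 64
        / (a ^ 3 * d * g * c ^ 2) := by positivity
    have : (w - 1) * (w * (w - 1) - 4 * (1 / (t * d)) * (w - 3)) / 4
        - ((w + 3) ^ 2 / 4 * ((w ^ 2 + 14 * w - 27 - 4 * w * (1 / (t * d)))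
          / (3 * w ^ 2 - 14 * w + 27)) - 3 * (1 / (t * d) - 1) - 36
          + 96 * (1 / (t * d) - 1) / (w - 1)) =
        (1 - 3 * t) ^ 2 * (256 * a ^ 6 + 1920 * t * a ^ 5 + 3712 * t ^ 2 * a ^ 4
        + 6912 * t ^ 3 * a ^ 3 + 3328 * t ^ 4 * a ^ 2 + 1920 * t ^ 5 * a + 384 * t ^ 6) / 64
        / (a ^ 3 * d * g * c ^ 2) := by
      rw [e6, e4, e3, e5, e2, e1]
      field_simp
      rw [hd, ha, hc, hg]
      ring
    rw [← this] at hpos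
    refine hpos.trans_eq ?_
    ring

theorem centerDist_six_le_nine (T : PlaneTriangle) :
    centerDist T 7 6 ≤ 1 / 3 * centerDist T 7 9 := by
  have := mul_centerDist_le_of_gergonneSq (i := 9) (j := 6) (a := 1) (b := 1 / 3) (by decide)
    (by decide) (by norm_num) (fun w u h => by linarith [nine_mul_gergonneSq_six_le h.isTriangleParam]) T
  linarith

theorem centerDist_six_le_four (T : PlaneTriangle) :
    centerDist T 7 6 ≤ centerDist T 7 4 := by
  have := mul_centerDist_le_of_gergonneSq (i := 4) (j := 6) (a := 1) (b := 1) (by decide)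
    (by decide) (by norm_num) (fun w u h => by linarith [gergonneSq_six_le_four h.isTriangleParam]) T
  linarith

/-! ### Transfer of bounds and sharpness from isosceles triangles -/

section Bounds

variable {i j : ℕ} {k : ℝ}

theorem lower_bound_of_isoDist (H : ∀ t : ℝ, 0 < t → t < 1 / 2 → k * isoDist j t ≤ isoDist i t)
    (hk : 0 ≤ k := by norm_num) (hi : i ∈ Finset.Icc 1 10 := by decide)
    (hj : j ∈ Finset.Icc 1 10 := by decide) (hi6 : i ≠ 6 := by decide)
    (hj6 : j ≠ 6 := by decide) (T : PlaneTriangle) :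
    k * centerDist T 7 j ≤ centerDist T 7 i := by
  simpa using mul_centerDist_le_of_isoDist hi hj hi6 hj6 (b := 1) hk zero_le_one
    (by simpa using H) T

theorem upper_bound_of_isoDist (H : ∀ t : ℝ, 0 < t → t < 1 / 2 → isoDist i t ≤ k * isoDist j t)
    (hk : 0 ≤ k := by norm_num) (hi : i ∈ Finset.Icc 1 10 := by decide)
    (hj : j ∈ Finset.Icc 1 10 := by decide) (hi6 : i ≠ 6 := by decide)
    (hj6 : j ≠ 6 := by decide) (T : PlaneTriangle) :
    centerDist T 7 i ≤ k * centerDist T 7 j := by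
  simpa using mul_centerDist_le_of_isoDist hj hi hj6 hi6 (a := 1) zero_le_one hk
    (by simpa using H) T

theorem lower_bound_zero (T : PlaneTriangle) :
    0 * centerDist T 7 j ≤ centerDist T 7 i := by
  rw [zero_mul]
  exact dist_nonneg

end Bounds

section Sharpness

variable {i j : ℕ} {k : ℝ}

/-- Contact at a single parameter suffices: once `m` is removed, `f / g` equals `k` there, and the
parameter may be a degenerate end that only limits of triangles reach. -/
theorem isBestLowerBound_of_isoDist (H : ∀ T, k * centerDist T 7 j ≤ centerDist T 7 i) (m f g : ℝ → ℝ)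
    (hm : ∀ t : ℝ, 0 < t → t < 1 / 2 → 0 < m t)
    (hf : ∀ t : ℝ, 0 < t → t < 1 / 2 → isoDist i t = m t * f t)
    (hg : ∀ t : ℝ, 0 < t → t < 1 / 2 → isoDist j t = m t * g t)
    (t : ℝ) (ht : t ∈ Set.Icc (0 : ℝ) (1 / 2))
    (hgt : 0 < g t) (hft : f t = k * g t) (hfc : Continuous f := by fun_prop)
    (hgc : Continuous g := by fun_prop) (hi : i ∈ Finset.Icc 1 10 := by decide)
    (hj : j ∈ Finset.Icc 1 10 := by decide) : IsBestLowerBound 7 i j k := by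
  refine ⟨H, fun q hq => ?_⟩
  have := le_of_forall_mul_centerDist_le hi hj (a := q) (b := 1)
    (fun T => by rw [one_mul]; exact hq T) m hm hf hg hfc hgc ht
  rw [one_mul, hft] at this
  exact le_of_mul_le_mul_right this hgt

theorem isBestUpperBound_of_isoDist (H : ∀ T, centerDist T 7 i ≤ k * centerDist T 7 j) (m f g : ℝ → ℝ)
    (hm : ∀ t : ℝ, 0 < t → t < 1 / 2 → 0 < m t)
    (hf : ∀ t : ℝ, 0 < t → t < 1 / 2 → isoDist i t = m t * f t)
    (hg : ∀ t : ℝ, 0 < t → t < 1 / 2 → isoDist j t = m t * g t)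
    (t : ℝ) (ht : t ∈ Set.Icc (0 : ℝ) (1 / 2))
    (hgt : 0 < g t) (hft : f t = k * g t) (hfc : Continuous f := by fun_prop)
    (hgc : Continuous g := by fun_prop) (hi : i ∈ Finset.Icc 1 10 := by decide)
    (hj : j ∈ Finset.Icc 1 10 := by decide) : IsBestUpperBound 7 i j k := by
  refine ⟨H, fun q hq => ?_⟩
  have := le_of_forall_mul_centerDist_le hj hi (a := 1) (b := q)
    (fun T => by rw [one_mul]; exact hq T) m hm hg hf hgc hfc ht
  rw [one_mul, hft] at this
  exact le_of_mul_le_mul_right this hgt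

/-- The ratio blows up near a parameter where the reduced denominator vanishes and the reduced
numerator does not. -/
theorem no_upper_bound_of_isoDist (m f g : ℝ → ℝ)
    (hm : ∀ t : ℝ, 0 < t → t < 1 / 2 → 0 < m t)
    (hf : ∀ t : ℝ, 0 < t → t < 1 / 2 → isoDist i t = m t * f t)
    (hg : ∀ t : ℝ, 0 < t → t < 1 / 2 → isoDist j t = m t * g t)
    (t : ℝ) (ht : t ∈ Set.Icc (0 : ℝ) (1 / 2))
    (hgt : g t = 0) (hft : 0 < f t) (hfc : Continuous f := by fun_prop)
    (hgc : Continuous g := by fun_prop) (hi : i ∈ Finset.Icc 1 10 := by decide)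
    (hj : j ∈ Finset.Icc 1 10 := by decide) :
    ¬ ∃ q : ℝ, ∀ T : PlaneTriangle, centerDist T 7 i ≤ q * centerDist T 7 j := by
  rintro ⟨q, hq⟩
  have := le_of_forall_mul_centerDist_le hj hi (a := 1) (b := q)
    (fun T => by rw [one_mul]; exact hq T) m hm hg hf hgc hfc ht
  rw [one_mul, hgt, mul_zero] at this
  exact absurd this (not_le.2 hft)

end Sharpness

/-- On isosceles triangles the two sides agree, so the reduction applies in both directions. -/
theorem centerDist_two_eq (T : PlaneTriangle) :
    centerDist T 7 2 = 2 / 3 * centerDist T 7 9 :=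
  le_antisymm
    (upper_bound_of_isoDist (fun t _ _ => by simp only [isoDist]; linarith) (T := T))
    (lower_bound_of_isoDist (fun t _ _ => by simp only [isoDist]; linarith) (T := T))

theorem centerDist_nine_le_eight (T : PlaneTriangle) :
    centerDist T 7 9 ≤ centerDist T 7 8 := by
  rw [← one_mul (centerDist T 7 9)]
  exact lower_bound_of_isoDist (fun t h0 h1 => by simp only [isoDist]; nlinarith) (T := T)

theorem centerDist_nine_le_ten (T : PlaneTriangle) :
    centerDist T 7 9 ≤ 4 / 3 * centerDist T 7 10 :=
  upper_bound_of_isoDist (fun t h0 h1 => by simp only [isoDist]; nlinarith) (T := T)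

theorem one_mul_centerDist_nine_le_three (T : PlaneTriangle) :
    1 * centerDist T 7 9 ≤ centerDist T 7 3 :=
  lower_bound_of_isoDist (fun t h0 h1 => by simp only [isoDist]; nlinarith) (T := T)

theorem centerDist_one_le_three (T : PlaneTriangle) :
    centerDist T 7 1 ≤ 2 / 17 * (5 - 2 * √2) * centerDist T 7 3 := by
  have h2 : √2 ^ 2 = (2 : ℝ) := Real.sq_sqrt zero_le_two
  have h3 : √2 < (3 / 2 : ℝ) := by rw [Real.sqrt_lt' (by norm_num)]; norm_num
  refine upper_bound_of_isoDist (fun t h0 h1 => ?_) (by linarith) (T := T)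
  simp only [isoDist]
  -- The constant makes the quadratic difference a perfect square; its double root `(4 - √2) / 7` is
  -- the interior maximizer of the ratio.
  have : 0 ≤ (29 + 2 * √2) / 17 * (t - (4 - √2) / 7) ^ 2 := by positivity
  linear_combination this + ((4 : ℝ) / 119 * t + (13 + 2 * √2) / 833) * h2

/-- The isosceles triangle with `X_5 = X_7`. -/
theorem isoDist_five_root : (1 / 2 - 5 / 4 * ((5 - √17) / 2) + 1 / 4 * ((5 - √17) / 2) ^ 2 : ℝ) = 0 := by
  have h : √17 ^ 2 = (17 : ℝ) := Real.sq_sqrt (by norm_num)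
  linear_combination h / 16

theorem isoDist_five_root_lower : (2 / 5 : ℝ) < (5 - √17) / 2 := by
  have : √17 < (21 / 5 : ℝ) := by rw [Real.sqrt_lt' (by norm_num)]; norm_num
  linarith

theorem isoDist_five_root_upper : (5 - √17) / 2 < (9 / 20 : ℝ) := by
  have : (41 / 10 : ℝ) < √17 := by rw [Real.lt_sqrt (by norm_num)]; norm_num
  linarith

theorem isoDist_five_root_mem : (5 - √17) / 2 ∈ Set.Icc (0 : ℝ) (1 / 2) :=
  ⟨by linarith [isoDist_five_root_lower], by linarith [isoDist_five_root_upper]⟩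

theorem isoDist_five_root_signs : 0 < (5 - √17) / 2 ∧ 0 < 1 - (5 - √17) / 2 ∧ 0 < 1 - 2 * ((5 - √17) / 2) ∧
    0 < 1 - 1 / 2 * ((5 - √17) / 2) ∧ 1 - 3 * ((5 - √17) / 2) ≠ 0 ∧
    0 < 1 - 3 / 2 * ((5 - √17) / 2) - 1 / 2 * ((5 - √17) / 2) ^ 2 := by
  have h1 := isoDist_five_root_lower
  have h2 := isoDist_five_root_upper
  generalize (5 - √17) / 2 = s at *
  exact ⟨by linarith, by linarith, by linarith, by linarith, by linarith, by nlinarith⟩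

theorem argmax_one_three_mem : (4 - √2) / 7 ∈ Set.Icc (0 : ℝ) (1 / 2) := by
  have h1 : (1 : ℝ) ≤ √2 := by rw [Real.one_le_sqrt]; norm_num
  have h2 : √2 < (3 / 2 : ℝ) := by rw [Real.sqrt_lt' (by norm_num)]; norm_num
  constructor <;> linarith

/-! ### Pairs with a nontrivial bound, except (3, 6) -/

theorem bestBounds_1_2 : BestBounds 7 1 2 0 (3 / 4) := by
  constructor
  · exact isBestLowerBound_of_isoDist lower_bound_zero (fun t => 1 - 2 * t)
      (fun t => t) (fun t => 2 / 3)
      (fun t _ h1 => by linarith)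
      (fun t _ _ => by simp only [isoDist]; ring)
      (fun t _ _ => by simp only [isoDist]; ring)
      (0) (⟨by norm_num, by norm_num⟩)
      (by norm_num) (by norm_num)
  · exact isBestUpperBound_of_isoDist (upper_bound_of_isoDist fun t h0 h1 => by
        simp only [isoDist]; nlinarith) (fun t => 1 - 2 * t)
      (fun t => t) (fun t => 2 / 3)
      (fun t _ h1 => by linarith)
      (fun t _ _ => by simp only [isoDist]; ring)
      (fun t _ _ => by simp only [isoDist]; ring)
      (1 / 2) (⟨by norm_num, by norm_num⟩)
      (by norm_num) (by norm_num)

theorem bestBounds_1_3 : BestBounds 7 1 3 0 (2 / 17 * (5 - 2 * √2)) := by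
  constructor
  · exact isBestLowerBound_of_isoDist lower_bound_zero (fun t => 1)
      (fun t => t * (1 - 2 * t)) (fun t => 1 - 3 / 2 * t - 1 / 2 * t ^ 2)
      (fun _ _ _ => one_pos)
      (fun t _ _ => by simp only [isoDist]; ring)
      (fun t _ _ => by simp only [isoDist]; ring)
      (0) (⟨by norm_num, by norm_num⟩)
      (by norm_num) (by norm_num)
  · exact isBestUpperBound_of_isoDist centerDist_one_le_three (fun t => 1)
      (fun t => t * (1 - 2 * t)) (fun t => 1 - 3 / 2 * t - 1 / 2 * t ^ 2)
      (fun _ _ _ => one_pos)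
      (fun t _ _ => by simp only [isoDist]; ring)
      (fun t _ _ => by simp only [isoDist]; ring)
      ((4 - √2) / 7) (argmax_one_three_mem)
      (by nlinarith [Real.sq_sqrt (zero_le_two (α := ℝ)), argmax_one_three_mem.2]) (by
        linear_combination (-2 / 833 * √2 + 29 / 833) * Real.sq_sqrt (zero_le_two (α := ℝ)))

theorem bestBounds_1_4 : BestBounds 7 1 4 0 1 := by
  constructor
  · exact isBestLowerBound_of_isoDist lower_bound_zero (fun t => t)
      (fun t => 1 - 2 * t) (fun t => 1 - t)
      (fun t h0 _ => h0)
      (fun _ _ _ => rfl)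
      (fun _ _ _ => rfl)
      (1 / 2) (⟨by norm_num, by norm_num⟩)
      (by norm_num) (by norm_num)
  · exact isBestUpperBound_of_isoDist (upper_bound_of_isoDist fun t h0 h1 => by
        simp only [isoDist]; nlinarith) (fun t => t)
      (fun t => 1 - 2 * t) (fun t => 1 - t)
      (fun t h0 _ => h0)
      (fun _ _ _ => rfl)
      (fun _ _ _ => rfl)
      (0) (⟨by norm_num, by norm_num⟩)
      (by norm_num) (by norm_num)

theorem bestBounds_1_8 : BestBounds 7 1 8 0 (1 / 2) := by
  constructor
  · exact isBestLowerBound_of_isoDist lower_bound_zero (fun t => 1 - 2 * t)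
      (fun t => t) (fun t => 2 * (1 - t))
      (fun t _ h1 => by linarith)
      (fun t _ _ => by simp only [isoDist]; ring)
      (fun t _ _ => by simp only [isoDist]; ring)
      (0) (⟨by norm_num, by norm_num⟩)
      (by norm_num) (by norm_num)
  · exact isBestUpperBound_of_isoDist (upper_bound_of_isoDist fun t h0 h1 => by
        simp only [isoDist]; nlinarith) (fun t => 1 - 2 * t)
      (fun t => t) (fun t => 2 * (1 - t))
      (fun t _ h1 => by linarith)
      (fun t _ _ => by simp only [isoDist]; ring)
      (fun t _ _ => by simp only [isoDist]; ring)
      (1 / 2) (⟨by norm_num, by norm_num⟩)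
      (by norm_num) (by norm_num)

theorem bestBounds_1_9 : BestBounds 7 1 9 0 (1 / 2) := by
  constructor
  · exact isBestLowerBound_of_isoDist lower_bound_zero (fun t => 1 - 2 * t)
      (fun t => t) (fun t => 1)
      (fun t _ h1 => by linarith)
      (fun t _ _ => by simp only [isoDist]; ring)
      (fun t _ _ => by simp only [isoDist]; ring)
      (0) (⟨by norm_num, by norm_num⟩)
      (by norm_num) (by norm_num)
  · exact isBestUpperBound_of_isoDist (upper_bound_of_isoDist fun t h0 h1 => by
        simp only [isoDist]; nlinarith) (fun t => 1 - 2 * t)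
      (fun t => t) (fun t => 1)
      (fun t _ h1 => by linarith)
      (fun t _ _ => by simp only [isoDist]; ring)
      (fun t _ _ => by simp only [isoDist]; ring)
      (1 / 2) (⟨by norm_num, by norm_num⟩)
      (by norm_num) (by norm_num)

theorem bestBounds_1_10 : BestBounds 7 1 10 0 (2 / 3) := by
  constructor
  · exact isBestLowerBound_of_isoDist lower_bound_zero (fun t => 1 - 2 * t)
      (fun t => t) (fun t => 1 - 1 / 2 * t)
      (fun t _ h1 => by linarith)
      (fun t _ _ => by simp only [isoDist]; ring)
      (fun t _ _ => by simp only [isoDist]; ring)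
      (0) (⟨by norm_num, by norm_num⟩)
      (by norm_num) (by norm_num)
  · exact isBestUpperBound_of_isoDist (upper_bound_of_isoDist fun t h0 h1 => by
        simp only [isoDist]; nlinarith) (fun t => 1 - 2 * t)
      (fun t => t) (fun t => 1 - 1 / 2 * t)
      (fun t _ h1 => by linarith)
      (fun t _ _ => by simp only [isoDist]; ring)
      (fun t _ _ => by simp only [isoDist]; ring)
      (1 / 2) (⟨by norm_num, by norm_num⟩)
      (by norm_num) (by norm_num)

theorem bestBounds_2_3 : BestBounds 7 2 3 0 (2 / 3) := by
  constructor
  · exact isBestLowerBound_of_isoDist lower_bound_zero (fun t => 1)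
      (fun t => 2 / 3 * (1 - 2 * t)) (fun t => 1 - 3 / 2 * t - 1 / 2 * t ^ 2)
      (fun _ _ _ => one_pos)
      (fun t _ _ => by simp only [isoDist]; ring)
      (fun t _ _ => by simp only [isoDist]; ring)
      (1 / 2) (⟨by norm_num, by norm_num⟩)
      (by norm_num) (by norm_num)
  · exact isBestUpperBound_of_isoDist (upper_bound_of_isoDist fun t h0 h1 => by
        simp only [isoDist]; nlinarith) (fun t => 1)
      (fun t => 2 / 3 * (1 - 2 * t)) (fun t => 1 - 3 / 2 * t - 1 / 2 * t ^ 2)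
      (fun _ _ _ => one_pos)
      (fun t _ _ => by simp only [isoDist]; ring)
      (fun t _ _ => by simp only [isoDist]; ring)
      (0) (⟨by norm_num, by norm_num⟩)
      (by norm_num) (by norm_num)

/-- Compare both distances with `D(7,9)`: one is exactly `2/3` of it, the other at most `1/3`. The
latter is sharp in the flat limit `t = 1 / 2`. -/
theorem bestBounds_2_6 : BestBoundsTop 7 2 6 2 := by
  constructor
  · exact isBestLowerBound_of_isoDist (fun T => by
        linarith [centerDist_six_le_nine T, centerDist_two_eq T]) (fun t => (1 - 2 * t) / (1 - 2 * t + 3 * t ^ 2))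
      (fun t => 2 / 3 * (1 - 2 * t + 3 * t ^ 2)) (fun t => t * |1 - 3 * t|)
      (fun t _ h1 => div_pos (by linarith) (isoDist_denom_pos t))
      (fun t _ _ => by
        have := isoDist_denom_pos t
        simp only [isoDist]
        generalize 1 - 2 * t + 3 * t ^ 2 = d at *
        field_simp)
      (fun t _ _ => by
        have := isoDist_denom_pos t
        simp only [isoDist]
        generalize 1 - 2 * t + 3 * t ^ 2 = d at *
        field_simp)
      (1 / 2) (⟨by norm_num, by norm_num⟩)
      (by norm_num) (by norm_num)
  · exact no_upper_bound_of_isoDist (fun t => (1 - 2 * t) / (1 - 2 * t + 3 * t ^ 2))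
      (fun t => 2 / 3 * (1 - 2 * t + 3 * t ^ 2)) (fun t => t * |1 - 3 * t|)
      (fun t _ h1 => div_pos (by linarith) (isoDist_denom_pos t))
      (fun t _ _ => by
        have := isoDist_denom_pos t
        simp only [isoDist]
        generalize 1 - 2 * t + 3 * t ^ 2 = d at *
        field_simp)
      (fun t _ _ => by
        have := isoDist_denom_pos t
        simp only [isoDist]
        generalize 1 - 2 * t + 3 * t ^ 2 = d at *
        field_simp)
      (0) (⟨by norm_num, by norm_num⟩)
      (by norm_num) (by norm_num)

theorem bestBounds_2_8 : BestBounds 7 2 8 (1 / 3) (2 / 3) := by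
  constructor
  · exact isBestLowerBound_of_isoDist (lower_bound_of_isoDist fun t h0 h1 => by
        simp only [isoDist]; nlinarith) (fun t => 1 - 2 * t)
      (fun t => 2 / 3) (fun t => 2 * (1 - t))
      (fun t _ h1 => by linarith)
      (fun t _ _ => by simp only [isoDist]; ring)
      (fun t _ _ => by simp only [isoDist]; ring)
      (0) (⟨by norm_num, by norm_num⟩)
      (by norm_num) (by norm_num)
  · exact isBestUpperBound_of_isoDist (upper_bound_of_isoDist fun t h0 h1 => by
        simp only [isoDist]; nlinarith) (fun t => 1 - 2 * t)
      (fun t => 2 / 3) (fun t => 2 * (1 - t))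
      (fun t _ h1 => by linarith)
      (fun t _ _ => by simp only [isoDist]; ring)
      (fun t _ _ => by simp only [isoDist]; ring)
      (1 / 2) (⟨by norm_num, by norm_num⟩)
      (by norm_num) (by norm_num)

theorem bestBounds_2_9 : BestBounds 7 2 9 (2 / 3) (2 / 3) := by
  constructor
  · exact isBestLowerBound_of_isoDist (fun T => (centerDist_two_eq T).ge) (fun t => 1 - 2 * t)
      (fun t => 2 / 3) (fun t => 1)
      (fun t _ h1 => by linarith)
      (fun t _ _ => by simp only [isoDist]; ring)
      (fun t _ _ => by simp only [isoDist]; ring)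
      (0) (⟨by norm_num, by norm_num⟩)
      (by norm_num) (by norm_num)
  · exact isBestUpperBound_of_isoDist (fun T => (centerDist_two_eq T).le) (fun t => 1 - 2 * t)
      (fun t => 2 / 3) (fun t => 1)
      (fun t _ h1 => by linarith)
      (fun t _ _ => by simp only [isoDist]; ring)
      (fun t _ _ => by simp only [isoDist]; ring)
      (0) (⟨by norm_num, by norm_num⟩)
      (by norm_num) (by norm_num)

theorem bestBounds_2_10 : BestBounds 7 2 10 (2 / 3) (8 / 9) := by
  constructor
  · exact isBestLowerBound_of_isoDist (lower_bound_of_isoDist fun t h0 h1 => by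
        simp only [isoDist]; nlinarith) (fun t => 1 - 2 * t)
      (fun t => 2 / 3) (fun t => 1 - 1 / 2 * t)
      (fun t _ h1 => by linarith)
      (fun t _ _ => by simp only [isoDist]; ring)
      (fun t _ _ => by simp only [isoDist]; ring)
      (0) (⟨by norm_num, by norm_num⟩)
      (by norm_num) (by norm_num)
  · exact isBestUpperBound_of_isoDist (upper_bound_of_isoDist fun t h0 h1 => by
        simp only [isoDist]; nlinarith) (fun t => 1 - 2 * t)
      (fun t => 2 / 3) (fun t => 1 - 1 / 2 * t)
      (fun t _ h1 => by linarith)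
      (fun t _ _ => by simp only [isoDist]; ring)
      (fun t _ _ => by simp only [isoDist]; ring)
      (1 / 2) (⟨by norm_num, by norm_num⟩)
      (by norm_num) (by norm_num)

theorem bestBounds_3_4 : BestBoundsTop 7 3 4 (1 / 2) := by
  constructor
  · exact isBestLowerBound_of_isoDist (lower_bound_of_isoDist fun t h0 h1 => by
        simp only [isoDist]; nlinarith) (fun t => 1)
      (fun t => 1 - 3 / 2 * t - 1 / 2 * t ^ 2) (fun t => t * (1 - t))
      (fun _ _ _ => one_pos)
      (fun t _ _ => by simp only [isoDist]; ring)
      (fun t _ _ => by simp only [isoDist]; ring)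
      (1 / 2) (⟨by norm_num, by norm_num⟩)
      (by norm_num) (by norm_num)
  · exact no_upper_bound_of_isoDist (fun t => 1)
      (fun t => 1 - 3 / 2 * t - 1 / 2 * t ^ 2) (fun t => t * (1 - t))
      (fun _ _ _ => one_pos)
      (fun t _ _ => by simp only [isoDist]; ring)
      (fun t _ _ => by simp only [isoDist]; ring)
      (0) (⟨by norm_num, by norm_num⟩)
      (by norm_num) (by norm_num)

theorem bestBounds_3_5 : BestBoundsTop 7 3 5 2 := by
  constructor
  · exact isBestLowerBound_of_isoDist (lower_bound_of_isoDist fun t h0 h1 => by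
        simp only [isoDist]; cases abs_cases (1 / 2 - 5 / 4 * t + 1 / 4 * t ^ 2) <;> nlinarith) (fun t => 1)
      (fun t => 1 - 3 / 2 * t - 1 / 2 * t ^ 2) (fun t => |1 / 2 - 5 / 4 * t + 1 / 4 * t ^ 2|)
      (fun _ _ _ => one_pos)
      (fun t _ _ => by simp only [isoDist]; ring)
      (fun t _ _ => by simp only [isoDist]; ring)
      (0) (⟨by norm_num, by norm_num⟩)
      (by norm_num) (by norm_num)
  · exact no_upper_bound_of_isoDist (fun t => 1)
      (fun t => 1 - 3 / 2 * t - 1 / 2 * t ^ 2) (fun t => |1 / 2 - 5 / 4 * t + 1 / 4 * t ^ 2|)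
      (fun _ _ _ => one_pos)
      (fun t _ _ => by simp only [isoDist]; ring)
      (fun t _ _ => by simp only [isoDist]; ring)
      -- At this non-equilateral parameter the nine-point center coincides with the Gergonne point
      -- while the circumcenter does not.
      ((5 - √17) / 2) (isoDist_five_root_mem)
      (by simp only [isoDist_five_root, abs_zero]) (by
        obtain ⟨h1, h2, h3, h4, h5, h6⟩ := isoDist_five_root_signs
        positivity)

theorem bestBounds_3_8 : BestBoundsTop 7 3 8 (1 / 2) := by
  constructor
  · exact isBestLowerBound_of_isoDist (lower_bound_of_isoDist fun t h0 h1 => by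
        simp only [isoDist]; nlinarith) (fun t => 1)
      (fun t => 1 - 3 / 2 * t - 1 / 2 * t ^ 2) (fun t => 2 * (1 - t) * (1 - 2 * t))
      (fun _ _ _ => one_pos)
      (fun t _ _ => by simp only [isoDist]; ring)
      (fun t _ _ => by simp only [isoDist]; ring)
      (0) (⟨by norm_num, by norm_num⟩)
      (by norm_num) (by norm_num)
  · exact no_upper_bound_of_isoDist (fun t => 1)
      (fun t => 1 - 3 / 2 * t - 1 / 2 * t ^ 2) (fun t => 2 * (1 - t) * (1 - 2 * t))
      (fun _ _ _ => one_pos)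
      (fun t _ _ => by simp only [isoDist]; ring)
      (fun t _ _ => by simp only [isoDist]; ring)
      (1 / 2) (⟨by norm_num, by norm_num⟩)
      (by norm_num) (by norm_num)

theorem bestBounds_3_9 : BestBoundsTop 7 3 9 1 := by
  constructor
  · exact isBestLowerBound_of_isoDist one_mul_centerDist_nine_le_three (fun t => 1)
      (fun t => 1 - 3 / 2 * t - 1 / 2 * t ^ 2) (fun t => 1 - 2 * t)
      (fun _ _ _ => one_pos)
      (fun t _ _ => by simp only [isoDist]; ring)
      (fun t _ _ => by simp only [isoDist]; ring)
      (0) (⟨by norm_num, by norm_num⟩)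
      (by norm_num) (by norm_num)
  · exact no_upper_bound_of_isoDist (fun t => 1)
      (fun t => 1 - 3 / 2 * t - 1 / 2 * t ^ 2) (fun t => 1 - 2 * t)
      (fun _ _ _ => one_pos)
      (fun t _ _ => by simp only [isoDist]; ring)
      (fun t _ _ => by simp only [isoDist]; ring)
      (1 / 2) (⟨by norm_num, by norm_num⟩)
      (by norm_num) (by norm_num)

theorem bestBounds_3_10 : BestBoundsTop 7 3 10 1 := by
  constructor
  · exact isBestLowerBound_of_isoDist (lower_bound_of_isoDist fun t h0 h1 => by
        simp only [isoDist]; nlinarith) (fun t => 1)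
      (fun t => 1 - 3 / 2 * t - 1 / 2 * t ^ 2) (fun t => (1 - 1 / 2 * t) * (1 - 2 * t))
      (fun _ _ _ => one_pos)
      (fun t _ _ => by simp only [isoDist]; ring)
      (fun t _ _ => by simp only [isoDist]; ring)
      (0) (⟨by norm_num, by norm_num⟩)
      (by norm_num) (by norm_num)
  · exact no_upper_bound_of_isoDist (fun t => 1)
      (fun t => 1 - 3 / 2 * t - 1 / 2 * t ^ 2) (fun t => (1 - 1 / 2 * t) * (1 - 2 * t))
      (fun _ _ _ => one_pos)
      (fun t _ _ => by simp only [isoDist]; ring)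
      (fun t _ _ => by simp only [isoDist]; ring)
      (1 / 2) (⟨by norm_num, by norm_num⟩)
      (by norm_num) (by norm_num)

theorem bestBounds_4_6 : BestBoundsTop 7 4 6 1 := by
  constructor
  · exact isBestLowerBound_of_isoDist (fun T => by
        rw [one_mul]; exact centerDist_six_le_four T) (fun t => t / (1 - 2 * t + 3 * t ^ 2))
      (fun t => (1 - t) * (1 - 2 * t + 3 * t ^ 2)) (fun t => |1 - 3 * t| * (1 - 2 * t))
      (fun t h0 _ => div_pos h0 (isoDist_denom_pos t))
      (fun t _ _ => by
        have := isoDist_denom_pos t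
        simp only [isoDist]
        generalize 1 - 2 * t + 3 * t ^ 2 = d at *
        field_simp)
      (fun t _ _ => by
        have := isoDist_denom_pos t
        simp only [isoDist]
        generalize 1 - 2 * t + 3 * t ^ 2 = d at *
        field_simp)
      (0) (⟨by norm_num, by norm_num⟩)
      (by norm_num) (by norm_num)
  · exact no_upper_bound_of_isoDist (fun t => t / (1 - 2 * t + 3 * t ^ 2))
      (fun t => (1 - t) * (1 - 2 * t + 3 * t ^ 2)) (fun t => |1 - 3 * t| * (1 - 2 * t))
      (fun t h0 _ => div_pos h0 (isoDist_denom_pos t))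
      (fun t _ _ => by
        have := isoDist_denom_pos t
        simp only [isoDist]
        generalize 1 - 2 * t + 3 * t ^ 2 = d at *
        field_simp)
      (fun t _ _ => by
        have := isoDist_denom_pos t
        simp only [isoDist]
        generalize 1 - 2 * t + 3 * t ^ 2 = d at *
        field_simp)
      (1 / 2) (⟨by norm_num, by norm_num⟩)
      (by norm_num) (by norm_num)

theorem bestBounds_6_8 : BestBounds 7 6 8 0 (1 / 3) := by
  constructor
  · exact isBestLowerBound_of_isoDist lower_bound_zero (fun t => (1 - 2 * t) / (1 - 2 * t + 3 * t ^ 2))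
      (fun t => t * |1 - 3 * t|) (fun t => 2 * (1 - t) * (1 - 2 * t + 3 * t ^ 2))
      (fun t _ h1 => div_pos (by linarith) (isoDist_denom_pos t))
      (fun t _ _ => by
        have := isoDist_denom_pos t
        simp only [isoDist]
        generalize 1 - 2 * t + 3 * t ^ 2 = d at *
        field_simp)
      (fun t _ _ => by
        have := isoDist_denom_pos t
        simp only [isoDist]
        generalize 1 - 2 * t + 3 * t ^ 2 = d at *
        field_simp)
      (0) (⟨by norm_num, by norm_num⟩)
      (by norm_num) (by norm_num)
  · exact isBestUpperBound_of_isoDist (fun T => by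
        linarith [centerDist_six_le_nine T, centerDist_nine_le_eight T]) (fun t => (1 - 2 * t) / (1 - 2 * t + 3 * t ^ 2))
      (fun t => t * |1 - 3 * t|) (fun t => 2 * (1 - t) * (1 - 2 * t + 3 * t ^ 2))
      (fun t _ h1 => div_pos (by linarith) (isoDist_denom_pos t))
      (fun t _ _ => by
        have := isoDist_denom_pos t
        simp only [isoDist]
        generalize 1 - 2 * t + 3 * t ^ 2 = d at *
        field_simp)
      (fun t _ _ => by
        have := isoDist_denom_pos t
        simp only [isoDist]
        generalize 1 - 2 * t + 3 * t ^ 2 = d at *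
        field_simp)
      (1 / 2) (⟨by norm_num, by norm_num⟩)
      (by norm_num) (by norm_num)

theorem bestBounds_6_9 : BestBounds 7 6 9 0 (1 / 3) := by
  constructor
  · exact isBestLowerBound_of_isoDist lower_bound_zero (fun t => (1 - 2 * t) / (1 - 2 * t + 3 * t ^ 2))
      (fun t => t * |1 - 3 * t|) (fun t => (1 - 2 * t + 3 * t ^ 2))
      (fun t _ h1 => div_pos (by linarith) (isoDist_denom_pos t))
      (fun t _ _ => by
        have := isoDist_denom_pos t
        simp only [isoDist]
        generalize 1 - 2 * t + 3 * t ^ 2 = d at *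
        field_simp)
      (fun t _ _ => by
        have := isoDist_denom_pos t
        simp only [isoDist]
        generalize 1 - 2 * t + 3 * t ^ 2 = d at *
        field_simp)
      (0) (⟨by norm_num, by norm_num⟩)
      (by norm_num) (by norm_num)
  · exact isBestUpperBound_of_isoDist centerDist_six_le_nine (fun t => (1 - 2 * t) / (1 - 2 * t + 3 * t ^ 2))
      (fun t => t * |1 - 3 * t|) (fun t => (1 - 2 * t + 3 * t ^ 2))
      (fun t _ h1 => div_pos (by linarith) (isoDist_denom_pos t))
      (fun t _ _ => by
        have := isoDist_denom_pos t
        simp only [isoDist]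
        generalize 1 - 2 * t + 3 * t ^ 2 = d at *
        field_simp)
      (fun t _ _ => by
        have := isoDist_denom_pos t
        simp only [isoDist]
        generalize 1 - 2 * t + 3 * t ^ 2 = d at *
        field_simp)
      (1 / 2) (⟨by norm_num, by norm_num⟩)
      (by norm_num) (by norm_num)

/-- The constant is the product `1/3 · 4/3` of the bounds for (6, 9) and (9, 10). Both are attained
in the limit `t = 1 / 2`, so chaining them loses nothing. -/
theorem bestBounds_6_10 : BestBounds 7 6 10 0 (4 / 9) := by
  constructor
  · exact isBestLowerBound_of_isoDist lower_bound_zero (fun t => (1 - 2 * t) / (1 - 2 * t + 3 * t ^ 2))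
      (fun t => t * |1 - 3 * t|) (fun t => (1 - 1 / 2 * t) * (1 - 2 * t + 3 * t ^ 2))
      (fun t _ h1 => div_pos (by linarith) (isoDist_denom_pos t))
      (fun t _ _ => by
        have := isoDist_denom_pos t
        simp only [isoDist]
        generalize 1 - 2 * t + 3 * t ^ 2 = d at *
        field_simp)
      (fun t _ _ => by
        have := isoDist_denom_pos t
        simp only [isoDist]
        generalize 1 - 2 * t + 3 * t ^ 2 = d at *
        field_simp)
      (0) (⟨by norm_num, by norm_num⟩)
      (by norm_num) (by norm_num)
  · exact isBestUpperBound_of_isoDist (fun T => by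
        linarith [centerDist_six_le_nine T, centerDist_nine_le_ten T]) (fun t => (1 - 2 * t) / (1 - 2 * t + 3 * t ^ 2))
      (fun t => t * |1 - 3 * t|) (fun t => (1 - 1 / 2 * t) * (1 - 2 * t + 3 * t ^ 2))
      (fun t _ h1 => div_pos (by linarith) (isoDist_denom_pos t))
      (fun t _ _ => by
        have := isoDist_denom_pos t
        simp only [isoDist]
        generalize 1 - 2 * t + 3 * t ^ 2 = d at *
        field_simp)
      (fun t _ _ => by
        have := isoDist_denom_pos t
        simp only [isoDist]
        generalize 1 - 2 * t + 3 * t ^ 2 = d at *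
        field_simp)
      (1 / 2) (⟨by norm_num, by norm_num⟩)
      (by norm_num) (by norm_num)

theorem bestBounds_8_9 : BestBounds 7 8 9 1 2 := by
  constructor
  · exact isBestLowerBound_of_isoDist (fun T => by
        rw [one_mul]; exact centerDist_nine_le_eight T) (fun t => 1 - 2 * t)
      (fun t => 2 * (1 - t)) (fun t => 1)
      (fun t _ h1 => by linarith)
      (fun t _ _ => by simp only [isoDist]; ring)
      (fun t _ _ => by simp only [isoDist]; ring)
      (1 / 2) (⟨by norm_num, by norm_num⟩)
      (by norm_num) (by norm_num)
  · exact isBestUpperBound_of_isoDist (upper_bound_of_isoDist fun t h0 h1 => by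
        simp only [isoDist]; nlinarith) (fun t => 1 - 2 * t)
      (fun t => 2 * (1 - t)) (fun t => 1)
      (fun t _ h1 => by linarith)
      (fun t _ _ => by simp only [isoDist]; ring)
      (fun t _ _ => by simp only [isoDist]; ring)
      (0) (⟨by norm_num, by norm_num⟩)
      (by norm_num) (by norm_num)

theorem bestBounds_8_10 : BestBounds 7 8 10 (4 / 3) 2 := by
  constructor
  · exact isBestLowerBound_of_isoDist (lower_bound_of_isoDist fun t h0 h1 => by
        simp only [isoDist]; nlinarith) (fun t => 1 - 2 * t)
      (fun t => 2 * (1 - t)) (fun t => 1 - 1 / 2 * t)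
      (fun t _ h1 => by linarith)
      (fun t _ _ => by simp only [isoDist]; ring)
      (fun t _ _ => by simp only [isoDist]; ring)
      (1 / 2) (⟨by norm_num, by norm_num⟩)
      (by norm_num) (by norm_num)
  · exact isBestUpperBound_of_isoDist (upper_bound_of_isoDist fun t h0 h1 => by
        simp only [isoDist]; nlinarith) (fun t => 1 - 2 * t)
      (fun t => 2 * (1 - t)) (fun t => 1 - 1 / 2 * t)
      (fun t _ h1 => by linarith)
      (fun t _ _ => by simp only [isoDist]; ring)
      (fun t _ _ => by simp only [isoDist]; ring)
      (0) (⟨by norm_num, by norm_num⟩)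
      (by norm_num) (by norm_num)

theorem bestBounds_9_10 : BestBounds 7 9 10 1 (4 / 3) := by
  constructor
  · exact isBestLowerBound_of_isoDist (lower_bound_of_isoDist fun t h0 h1 => by
        simp only [isoDist]; nlinarith) (fun t => 1 - 2 * t)
      (fun t => 1) (fun t => 1 - 1 / 2 * t)
      (fun t _ h1 => by linarith)
      (fun t _ _ => by simp only [isoDist]; ring)
      (fun t _ _ => by simp only [isoDist]; ring)
      (0) (⟨by norm_num, by norm_num⟩)
      (by norm_num) (by norm_num)
  · exact isBestUpperBound_of_isoDist centerDist_nine_le_ten (fun t => 1 - 2 * t)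
      (fun t => 1) (fun t => 1 - 1 / 2 * t)
      (fun t _ h1 => by linarith)
      (fun t _ _ => by simp only [isoDist]; ring)
      (fun t _ _ => by simp only [isoDist]; ring)
      (1 / 2) (⟨by norm_num, by norm_num⟩)
      (by norm_num) (by norm_num)

/-! ### Pairs with trivial bounds only -/

theorem bestBounds_1_5 : BestBoundsTop 7 1 5 0 := by
  constructor
  · exact isBestLowerBound_of_isoDist lower_bound_zero (fun t => 1)
      (fun t => t * (1 - 2 * t)) (fun t => |1 / 2 - 5 / 4 * t + 1 / 4 * t ^ 2|)
      (fun _ _ _ => one_pos)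
      (fun t _ _ => by simp only [isoDist]; ring)
      (fun t _ _ => by simp only [isoDist]; ring)
      (0) (⟨by norm_num, by norm_num⟩)
      (by norm_num) (by norm_num)
  · exact no_upper_bound_of_isoDist (fun t => 1)
      (fun t => t * (1 - 2 * t)) (fun t => |1 / 2 - 5 / 4 * t + 1 / 4 * t ^ 2|)
      (fun _ _ _ => one_pos)
      (fun t _ _ => by simp only [isoDist]; ring)
      (fun t _ _ => by simp only [isoDist]; ring)
      ((5 - √17) / 2) (isoDist_five_root_mem)
      (by simp only [isoDist_five_root, abs_zero]) (by
        obtain ⟨h1, h2, h3, h4, h5, h6⟩ := isoDist_five_root_signs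
        positivity)

theorem bestBounds_2_4 : BestBoundsTop 7 2 4 0 := by
  constructor
  · exact isBestLowerBound_of_isoDist lower_bound_zero (fun t => 1)
      (fun t => 2 / 3 * (1 - 2 * t)) (fun t => t * (1 - t))
      (fun _ _ _ => one_pos)
      (fun t _ _ => by simp only [isoDist]; ring)
      (fun t _ _ => by simp only [isoDist]; ring)
      (1 / 2) (⟨by norm_num, by norm_num⟩)
      (by norm_num) (by norm_num)
  · exact no_upper_bound_of_isoDist (fun t => 1)
      (fun t => 2 / 3 * (1 - 2 * t)) (fun t => t * (1 - t))
      (fun _ _ _ => one_pos)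
      (fun t _ _ => by simp only [isoDist]; ring)
      (fun t _ _ => by simp only [isoDist]; ring)
      (0) (⟨by norm_num, by norm_num⟩)
      (by norm_num) (by norm_num)

theorem bestBounds_2_5 : BestBoundsTop 7 2 5 0 := by
  constructor
  · exact isBestLowerBound_of_isoDist lower_bound_zero (fun t => 1)
      (fun t => 2 / 3 * (1 - 2 * t)) (fun t => |1 / 2 - 5 / 4 * t + 1 / 4 * t ^ 2|)
      (fun _ _ _ => one_pos)
      (fun t _ _ => by simp only [isoDist]; ring)
      (fun t _ _ => by simp only [isoDist]; ring)
      (1 / 2) (⟨by norm_num, by norm_num⟩)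
      (by norm_num) (by norm_num)
  · exact no_upper_bound_of_isoDist (fun t => 1)
      (fun t => 2 / 3 * (1 - 2 * t)) (fun t => |1 / 2 - 5 / 4 * t + 1 / 4 * t ^ 2|)
      (fun _ _ _ => one_pos)
      (fun t _ _ => by simp only [isoDist]; ring)
      (fun t _ _ => by simp only [isoDist]; ring)
      ((5 - √17) / 2) (isoDist_five_root_mem)
      (by simp only [isoDist_five_root, abs_zero]) (by
        obtain ⟨h1, h2, h3, h4, h5, h6⟩ := isoDist_five_root_signs
        positivity)

theorem bestBounds_4_5 : BestBoundsTop 7 4 5 0 := by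
  constructor
  · exact isBestLowerBound_of_isoDist lower_bound_zero (fun t => 1)
      (fun t => t * (1 - t)) (fun t => |1 / 2 - 5 / 4 * t + 1 / 4 * t ^ 2|)
      (fun _ _ _ => one_pos)
      (fun t _ _ => by simp only [isoDist]; ring)
      (fun t _ _ => by simp only [isoDist]; ring)
      (0) (⟨by norm_num, by norm_num⟩)
      (by norm_num) (by norm_num)
  · exact no_upper_bound_of_isoDist (fun t => 1)
      (fun t => t * (1 - t)) (fun t => |1 / 2 - 5 / 4 * t + 1 / 4 * t ^ 2|)
      (fun _ _ _ => one_pos)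
      (fun t _ _ => by simp only [isoDist]; ring)
      (fun t _ _ => by simp only [isoDist]; ring)
      ((5 - √17) / 2) (isoDist_five_root_mem)
      (by simp only [isoDist_five_root, abs_zero]) (by
        obtain ⟨h1, h2, h3, h4, h5, h6⟩ := isoDist_five_root_signs
        positivity)

theorem bestBounds_4_8 : BestBoundsTop 7 4 8 0 := by
  constructor
  · exact isBestLowerBound_of_isoDist lower_bound_zero (fun t => 1 - t)
      (fun t => t) (fun t => 2 * (1 - 2 * t))
      (fun t _ h1 => by linarith)
      (fun t _ _ => by simp only [isoDist]; ring)
      (fun t _ _ => by simp only [isoDist]; ring)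
      (0) (⟨by norm_num, by norm_num⟩)
      (by norm_num) (by norm_num)
  · exact no_upper_bound_of_isoDist (fun t => 1 - t)
      (fun t => t) (fun t => 2 * (1 - 2 * t))
      (fun t _ h1 => by linarith)
      (fun t _ _ => by simp only [isoDist]; ring)
      (fun t _ _ => by simp only [isoDist]; ring)
      (1 / 2) (⟨by norm_num, by norm_num⟩)
      (by norm_num) (by norm_num)

theorem bestBounds_4_9 : BestBoundsTop 7 4 9 0 := by
  constructor
  · exact isBestLowerBound_of_isoDist lower_bound_zero (fun t => 1)
      (fun t => t * (1 - t)) (fun t => 1 - 2 * t)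
      (fun _ _ _ => one_pos)
      (fun t _ _ => by simp only [isoDist]; ring)
      (fun t _ _ => by simp only [isoDist]; ring)
      (0) (⟨by norm_num, by norm_num⟩)
      (by norm_num) (by norm_num)
  · exact no_upper_bound_of_isoDist (fun t => 1)
      (fun t => t * (1 - t)) (fun t => 1 - 2 * t)
      (fun _ _ _ => one_pos)
      (fun t _ _ => by simp only [isoDist]; ring)
      (fun t _ _ => by simp only [isoDist]; ring)
      (1 / 2) (⟨by norm_num, by norm_num⟩)
      (by norm_num) (by norm_num)

theorem bestBounds_4_10 : BestBoundsTop 7 4 10 0 := by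
  constructor
  · exact isBestLowerBound_of_isoDist lower_bound_zero (fun t => 1)
      (fun t => t * (1 - t)) (fun t => (1 - 1 / 2 * t) * (1 - 2 * t))
      (fun _ _ _ => one_pos)
      (fun t _ _ => by simp only [isoDist]; ring)
      (fun t _ _ => by simp only [isoDist]; ring)
      (0) (⟨by norm_num, by norm_num⟩)
      (by norm_num) (by norm_num)
  · exact no_upper_bound_of_isoDist (fun t => 1)
      (fun t => t * (1 - t)) (fun t => (1 - 1 / 2 * t) * (1 - 2 * t))
      (fun _ _ _ => one_pos)
      (fun t _ _ => by simp only [isoDist]; ring)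
      (fun t _ _ => by simp only [isoDist]; ring)
      (1 / 2) (⟨by norm_num, by norm_num⟩)
      (by norm_num) (by norm_num)

theorem bestBounds_5_6 : BestBoundsTop 7 5 6 0 := by
  constructor
  · exact isBestLowerBound_of_isoDist lower_bound_zero (fun t => 1 / (1 - 2 * t + 3 * t ^ 2))
      (fun t => |1 / 2 - 5 / 4 * t + 1 / 4 * t ^ 2| * (1 - 2 * t + 3 * t ^ 2)) (fun t => t * |1 - 3 * t| * (1 - 2 * t))
      (fun t _ _ => one_div_pos.2 (isoDist_denom_pos t))
      (fun t _ _ => by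
        have := isoDist_denom_pos t
        simp only [isoDist]
        generalize 1 - 2 * t + 3 * t ^ 2 = d at *
        field_simp)
      (fun t _ _ => by
        have := isoDist_denom_pos t
        simp only [isoDist]
        generalize 1 - 2 * t + 3 * t ^ 2 = d at *
        field_simp)
      ((5 - √17) / 2) (isoDist_five_root_mem)
      (by
        obtain ⟨h1, h2, h3, h4, h5, h6⟩ := isoDist_five_root_signs
        positivity) (by simp only [isoDist_five_root, abs_zero, zero_mul])
  · exact no_upper_bound_of_isoDist (fun t => 1 / (1 - 2 * t + 3 * t ^ 2))
      (fun t => |1 / 2 - 5 / 4 * t + 1 / 4 * t ^ 2| * (1 - 2 * t + 3 * t ^ 2)) (fun t => t * |1 - 3 * t| * (1 - 2 * t))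
      (fun t _ _ => one_div_pos.2 (isoDist_denom_pos t))
      (fun t _ _ => by
        have := isoDist_denom_pos t
        simp only [isoDist]
        generalize 1 - 2 * t + 3 * t ^ 2 = d at *
        field_simp)
      (fun t _ _ => by
        have := isoDist_denom_pos t
        simp only [isoDist]
        generalize 1 - 2 * t + 3 * t ^ 2 = d at *
        field_simp)
      (0) (⟨by norm_num, by norm_num⟩)
      (by norm_num) (by norm_num)

theorem bestBounds_5_8 : BestBoundsTop 7 5 8 0 := by
  constructor
  · exact isBestLowerBound_of_isoDist lower_bound_zero (fun t => 1)
      (fun t => |1 / 2 - 5 / 4 * t + 1 / 4 * t ^ 2|) (fun t => 2 * (1 - t) * (1 - 2 * t))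
      (fun _ _ _ => one_pos)
      (fun t _ _ => by simp only [isoDist]; ring)
      (fun t _ _ => by simp only [isoDist]; ring)
      ((5 - √17) / 2) (isoDist_five_root_mem)
      (by
        obtain ⟨h1, h2, h3, h4, h5, h6⟩ := isoDist_five_root_signs
        positivity) (by simp only [isoDist_five_root, abs_zero, zero_mul])
  · exact no_upper_bound_of_isoDist (fun t => 1)
      (fun t => |1 / 2 - 5 / 4 * t + 1 / 4 * t ^ 2|) (fun t => 2 * (1 - t) * (1 - 2 * t))
      (fun _ _ _ => one_pos)
      (fun t _ _ => by simp only [isoDist]; ring)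
      (fun t _ _ => by simp only [isoDist]; ring)
      (1 / 2) (⟨by norm_num, by norm_num⟩)
      (by norm_num) (by norm_num)

theorem bestBounds_5_9 : BestBoundsTop 7 5 9 0 := by
  constructor
  · exact isBestLowerBound_of_isoDist lower_bound_zero (fun t => 1)
      (fun t => |1 / 2 - 5 / 4 * t + 1 / 4 * t ^ 2|) (fun t => 1 - 2 * t)
      (fun _ _ _ => one_pos)
      (fun t _ _ => by simp only [isoDist]; ring)
      (fun t _ _ => by simp only [isoDist]; ring)
      ((5 - √17) / 2) (isoDist_five_root_mem)
      (by
        obtain ⟨h1, h2, h3, h4, h5, h6⟩ := isoDist_five_root_signs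
        positivity) (by simp only [isoDist_five_root, abs_zero, zero_mul])
  · exact no_upper_bound_of_isoDist (fun t => 1)
      (fun t => |1 / 2 - 5 / 4 * t + 1 / 4 * t ^ 2|) (fun t => 1 - 2 * t)
      (fun _ _ _ => one_pos)
      (fun t _ _ => by simp only [isoDist]; ring)
      (fun t _ _ => by simp only [isoDist]; ring)
      (1 / 2) (⟨by norm_num, by norm_num⟩)
      (by norm_num) (by norm_num)

theorem bestBounds_5_10 : BestBoundsTop 7 5 10 0 := by
  constructor
  · exact isBestLowerBound_of_isoDist lower_bound_zero (fun t => 1)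
      (fun t => |1 / 2 - 5 / 4 * t + 1 / 4 * t ^ 2|) (fun t => (1 - 1 / 2 * t) * (1 - 2 * t))
      (fun _ _ _ => one_pos)
      (fun t _ _ => by simp only [isoDist]; ring)
      (fun t _ _ => by simp only [isoDist]; ring)
      ((5 - √17) / 2) (isoDist_five_root_mem)
      (by
        obtain ⟨h1, h2, h3, h4, h5, h6⟩ := isoDist_five_root_signs
        positivity) (by simp only [isoDist_five_root, abs_zero, zero_mul])
  · exact no_upper_bound_of_isoDist (fun t => 1)
      (fun t => |1 / 2 - 5 / 4 * t + 1 / 4 * t ^ 2|) (fun t => (1 - 1 / 2 * t) * (1 - 2 * t))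
      (fun _ _ _ => one_pos)
      (fun t _ _ => by simp only [isoDist]; ring)
      (fun t _ _ => by simp only [isoDist]; ring)
      (1 / 2) (⟨by norm_num, by norm_num⟩)
      (by norm_num) (by norm_num)

theorem le_at_zero_of_le_on_pos {f g : ℝ → ℝ} (hf : ContinuousAt f 0) (hg : ContinuousAt g 0)
    (H : ∀ s : ℝ, 0 < s → f s ≤ g s) : f 0 ≤ g 0 :=
  le_of_tendsto_of_tendsto (hf.tendsto.mono_left nhdsWithin_le_nhds)
    (hg.tendsto.mono_left nhdsWithin_le_nhds)
    (Filter.eventually_of_mem (self_mem_nhdsWithin (s := Set.Ioi (0 : ℝ))) H)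

/-- In the degenerating triangles with tangent lengths `2, 1, s`, `s → 0`, the incenter
approaches the Gergonne point, the symmedian point does not. -/
theorem bestBounds_1_6 : BestBoundsTop 7 1 6 0 := by
  constructor
  · refine ⟨lower_bound_zero, fun q hq => ?_⟩
    by_contra! hq0
    -- Isosceles triangles are of no use here, since on them `D(7,1) ≥ D(7,6)`. The squared
    -- inequality is multiplied by `4 (u - 1) ^ 2 s ^ 2`, which cancels the pole of `w` and makes
    -- both sides continuous at `s = 0`.
    have key : ∀ s : ℝ, 0 < s →
        q ^ 2 * (((3 + s) * (2 + 3 * s) / 2 + 3 * s) ^ 2 * ((3 + s) ^ 2 / (2 + 3 * s) - 1)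
          - 12 * ((3 + s) ^ 2 / (2 + 3 * s) - 1) ^ 3 * s ^ 2
          - 3 * ((3 + s) * (2 + 3 * s) / 2 - s) ^ 2)
        ≤ 4 * ((3 + s) ^ 2 / (2 + 3 * s) - 1) ^ 2
          * (s * ((3 + s) * (2 + 3 * s) / 2 - 3 * s * ((3 + s) ^ 2 / (2 + 3 * s)))) := by
      intro s hs
      obtain ⟨T, hT⟩ := exists_triangle two_pos one_pos hs
      have h : (q * centerDist T 7 6) ^ 2 ≤ centerDist T 7 1 ^ 2 :=
        pow_le_pow_left₀ (mul_nonneg hq0.le dist_nonneg) (hq T) 2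
      rw [mul_pow, hT.centerDist_sq (n := 6) (by decide), hT.centerDist_sq (n := 1) (by decide),
        mul_left_comm] at h
      replace h := le_of_mul_le_mul_left h (by positivity)
      have e1 : (2 + 1 + s) * (2 * 1 + 1 * s + s * 2) / (2 * 1 * s)
          = (3 + s) * (2 + 3 * s) / 2 / s := by
        field_simp; ring
      have e2 : (2 + 1 + s) ^ 2 / (2 * 1 + 1 * s + s * 2) = (3 + s) ^ 2 / (2 + 3 * s) := by
        congr 1 <;> ring
      have hτ : 0 < (3 + s) ^ 2 / (2 + 3 * s) - 1 := by
        rw [sub_pos, lt_div_iff₀ (by positivity)]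
        nlinarith
      rw [e1, e2] at h
      generalize (3 + s) ^ 2 / (2 + 3 * s) = u at *
      generalize (3 + s) * (2 + 3 * s) / 2 = W at *
      simp only [gergonneSq] at h
      obtain ⟨τ, rfl⟩ : ∃ τ, u = τ + 1 := ⟨u - 1, by ring⟩
      simp only [add_sub_cancel_right] at *
      have := mul_le_mul_of_nonneg_left h (show 0 ≤ 4 * τ ^ 2 * s ^ 2 by positivity)
      field_simp at this
      nlinarith
    -- At `s = 0` the left side is `9 / 2 * q ^ 2` and the right side is `0`.
    have := le_at_zero_of_le_on_pos (by fun_prop (disch := norm_num))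
      (by fun_prop (disch := norm_num)) key
    norm_num at this
    nlinarith [pow_pos hq0 2]
  · exact no_upper_bound_of_isoDist (fun t => t * (1 - 2 * t) / (1 - 2 * t + 3 * t ^ 2))
      (fun t => 1 - 2 * t + 3 * t ^ 2) (fun t => |1 - 3 * t|)
      (fun t h0 h1 => div_pos (mul_pos h0 (by linarith)) (isoDist_denom_pos t))
      (fun t _ _ => by
        have := isoDist_denom_pos t
        simp only [isoDist]
        generalize 1 - 2 * t + 3 * t ^ 2 = d at *
        field_simp)
      (fun t _ _ => by
        have := isoDist_denom_pos t
        simp only [isoDist]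
        generalize 1 - 2 * t + 3 * t ^ 2 = d at *
        field_simp)
      (1 / 3) ⟨by norm_num, by norm_num⟩ (by norm_num) (by norm_num)

/-! ### The degree 28 polynomial and its largest root -/

/-- The polynomial `polyC7` in the variable `k = x²`. -/
def sextPoly (k : ℝ) : ℝ :=
  833089536 * k ^ 14 + 220028016384 * k ^ 13 - 19474287964848 * k ^ 12
    + 139707882692901 * k ^ 11 - 410390834384412 * k ^ 10 + 732430210466916 * k ^ 9
    - 892396597211316 * k ^ 8 + 782711166381062 * k ^ 7 - 492062343977916 * k ^ 6
    + 216425700787620 * k ^ 5 - 65960002546284 * k ^ 4 + 14226627485565 * k ^ 3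
    - 2259294716376 * k ^ 2 + 253570773456 * k - 14637417984

theorem polyC7_isRoot_iff (x : ℝ) : polyC7.IsRoot x ↔ sextPoly (x ^ 2) = 0 := by
  have : polyC7.eval x = sextPoly (x ^ 2) := by
    simp only [polyC7, sextPoly, eval_add, eval_sub, eval_mul, eval_pow, eval_X, eval_ofNat]
    ring
  rw [IsRoot.def, this]

theorem pow_mul_pow_le {a b : ℝ} (ha : 0 ≤ a) (hab : a ≤ b) {m n : ℕ} (hmn : m ≤ n) :
    a ^ n * b ^ m ≤ b ^ n * a ^ m := by
  obtain ⟨l, rfl⟩ := Nat.exists_eq_add_of_le hmn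
  have h1 : a ^ l ≤ b ^ l := pow_le_pow_left₀ ha hab l
  have h2 : 0 ≤ a ^ m * b ^ m := mul_nonneg (pow_nonneg ha _) (pow_nonneg (ha.trans hab) _)
  calc a ^ (m + l) * b ^ m = a ^ m * b ^ m * a ^ l := by ring
    _ ≤ a ^ m * b ^ m * b ^ l := mul_le_mul_of_nonneg_left h1 h2
    _ = b ^ (m + l) * a ^ m := by ring

/-- The Taylor coefficients of `sextPoly` at `9` change sign once. -/
theorem sextPoly_pos_of_lt {k l : ℝ} (hk : 9 ≤ k) (hkl : k < l) (h : 0 ≤ sextPoly k) :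
    0 < sextPoly l := by
  obtain ⟨a, rfl⟩ : ∃ a, k = a + 9 := ⟨k - 9, by ring⟩
  obtain ⟨b, rfl⟩ : ∃ b, l = b + 9 := ⟨l - 9, by ring⟩
  have ha : 0 ≤ a := by linarith
  have hab : a < b := by linarith
  have expand : ∀ v : ℝ, sextPoly (v + 9) = 833089536 * v ^ 14 + 324997297920 * v ^ 13
      + 12409692921936 * v ^ 12 - (352312903081755 * v ^ 11 + 39342966313757229 * v ^ 10
      + 1406429108979799761 * v ^ 9 + 29828420106166073115 * v ^ 8
      + 427762806367034835256 * v ^ 7 + 4360533160148300157732 * v ^ 6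
      + 32169328266460921496952 * v ^ 5 + 171333539695024264496064 * v ^ 4
      + 644233554022809355614144 * v ^ 3 + 1625891992183017186048000 * v ^ 2
      + 2475125625813819653355264 * v + 1719698714443724957190144) := by
    intro v
    simp only [sextPoly]
    ring
  rw [expand] at h
  -- `sextPoly 9` is negative.
  have ha0 : 0 < a := by
    rcases ha.eq_or_lt with rfl | h'
    · norm_num at h
    · exact h'
  -- The single sign change lies between degrees 11 and 12. So `a ^ 12 * sextPoly (b + 9)` exceeds
  -- `b ^ 12 * sextPoly (a + 9)` term by term, strictly in the constant term.
  have hpos : 0 < a ^ 12 * sextPoly (b + 9) := by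
    have hs : a ^ 12 < b ^ 12 := pow_lt_pow_left₀ hab ha (by norm_num)
    have e13 := pow_mul_pow_le ha hab.le (show 12 ≤ 13 by norm_num)
    have e14 := pow_mul_pow_le ha hab.le (show 12 ≤ 14 by norm_num)
    have e11 := pow_mul_pow_le ha hab.le (show 11 ≤ 12 by norm_num)
    have e10 := pow_mul_pow_le ha hab.le (show 10 ≤ 12 by norm_num)
    have e9 := pow_mul_pow_le ha hab.le (show 9 ≤ 12 by norm_num)
    have e8 := pow_mul_pow_le ha hab.le (show 8 ≤ 12 by norm_num)
    have e7 := pow_mul_pow_le ha hab.le (show 7 ≤ 12 by norm_num)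
    have e6 := pow_mul_pow_le ha hab.le (show 6 ≤ 12 by norm_num)
    have e5 := pow_mul_pow_le ha hab.le (show 5 ≤ 12 by norm_num)
    have e4 := pow_mul_pow_le ha hab.le (show 4 ≤ 12 by norm_num)
    have e3 := pow_mul_pow_le ha hab.le (show 3 ≤ 12 by norm_num)
    have e2 := pow_mul_pow_le ha hab.le (show 2 ≤ 12 by norm_num)
    have e1 := pow_mul_pow_le ha hab.le (show 1 ≤ 12 by norm_num)
    have hb := mul_nonneg (pow_nonneg (ha.trans hab.le) 12) h
    rw [expand]
    linarith
  exact pos_of_mul_pos_right hpos (by positivity)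

/-- `sextPoly` stays positive after its first root in `[9, ∞)`, so a root there is the largest one.
Its decimals follow from the signs of `sextPoly` at the two ends of the interval. -/
theorem isGreatest_sqrt {k : ℝ} (hk : 9 ≤ k) (h : sextPoly k = 0) :
    IsGreatest {x : ℝ | polyC7.IsRoot x} √k ∧ |√k - 7.9776615835| < 0.00000000005 := by
  have hk0 : 0 ≤ k := by linarith
  refine ⟨⟨?_, fun x hx => ?_⟩, ?_⟩
  · rw [Set.mem_ofPred_eq, polyC7_isRoot_iff, Real.sq_sqrt hk0, h]
  · rw [Set.mem_ofPred_eq, polyC7_isRoot_iff] at hx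
    refine Real.le_sqrt_of_sq_le ?_
    by_contra! hlt
    exact (sextPoly_pos_of_lt hk hlt h.ge).ne' hx
  · rw [abs_lt]
    constructor
    · rw [lt_sub_iff_add_lt, Real.lt_sqrt (by norm_num)]
      by_contra! hlt
      have hneg : sextPoly ((-0.00000000005 + 7.9776615835) ^ 2) < 0 := by
        norm_num [sextPoly]
      rcases hlt.eq_or_lt with h' | h'
      · rw [← h', h] at hneg
        exact lt_irrefl _ hneg
      · exact lt_asymm hneg (sextPoly_pos_of_lt hk h' h.ge)
    · rw [sub_lt_iff_lt_add, Real.sqrt_lt' (by norm_num)]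
      by_contra! hlt
      have hpos : 0 < sextPoly ((0.00000000005 + 7.9776615835) ^ 2) := by
        norm_num [sextPoly]
      rcases hlt.eq_or_lt with h' | h'
      · rw [h', h] at hpos
        exact lt_irrefl _ hpos
      · exact (sextPoly_pos_of_lt (by norm_num) h' hpos.le).ne' h

/-- The critical values `k` of the ratio `D(7, 3)² / D(7, 6)²` (cleared of denominators) are roots
of `sextPoly`. -/
theorem elimination_certificate {w t k : ℝ}
    (hF : t ^ 2 * (w * (w - 1) ^ 2 - 16 * (w + 3) * (1 + t))
      - 4 * k * ((w + 3) ^ 2 * t - 12 * t ^ 3 - 3 * (w - 1) ^ 2) = 0)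
    (hw : t ^ 2 * (3 * w ^ 2 - 4 * w + 1 - 16 * (1 + t))
      - 4 * k * (2 * (w + 3) * t - 6 * (w - 1)) = 0)
    (ht : 2 * t * (w * (w - 1) ^ 2 - 16 * (w + 3) * (1 + t)) - 16 * t ^ 2 * (w + 3)
      - 4 * k * ((w + 3) ^ 2 - 36 * t ^ 2) = 0) :
    t ^ 2 * sextPoly k = 0 := by
  -- By Euler's operator, `3 F - t ∂F/∂t` removes the terms cubic in `t`.
  have hQ : t ^ 2 * (w ^ 3 - 2 * w ^ 2 - 15 * w - 48)
      - 4 * k * (2 * (w + 3) ^ 2 * t - 9 * (w - 1) ^ 2) = 0 := by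
    linear_combination 3 * hF - t * ht
  rw [sextPoly]
  -- Explicit cofactors showing that `t ^ 2 * sextPoly k` lies in the ideal generated by the
  -- function and its two partial derivatives, with `hQ` as an auxiliary generator. The factor `t ^
  -- 2` is harmless because `τ > 2` in the application.
  linear_combination (1 / 147456 : ℝ) * (
    ((- 564350976 * k ^ 13 - 147613052160 * k ^ 12 + 13473757324944 * k ^ 11 - 160831922192487 * k
      ^ 10 + 582453500619627 * k ^ 9 - 468644778772821 * k ^ 8 - 1236530829623481 * k ^ 7 +
      3748579388636481 * k ^ 6 - 4643839607223663 * k ^ 5 + 3673337474025513 * k ^ 4 -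
      1591321392642051 * k ^ 3 + 357215341211442 * k ^ 2 - 51263416744848 * k + 5294955264480) * w
      ^ 4
    + (- 349360128 * k ^ 14 - 86058484992 * k ^ 13 + 9721641400848 * k ^ 12 - 227981367042543 * k
      ^ 11 + 2687428690297461 * k ^ 10 - 12177010108699263 * k ^ 9 + 24518061746387721 * k ^ 8 -
      27663742668746529 * k ^ 7 + 16988554034945295 * k ^ 6 - 3290864401282581 * k ^ 5 -
      4997450326187565 * k ^ 4 + 3690899968420260 * k ^ 3 - 948672465661872 * k ^ 2 +
      144763585031232 * k - 16990457605632) * w ^ 3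
    + (4299816960 * k ^ 13 + 1127250763776 * k ^ 12 - 101922007601664 * k ^ 11 + 1181643991496928
      * k ^ 10 - 4377845170813248 * k ^ 9 + 4271968876006656 * k ^ 8 + 6776704164100032 * k ^ 7 -
      23326701306717504 * k ^ 6 + 29498992026661440 * k ^ 5 - 23576409484028928 * k ^ 4 +
      10264604237787456 * k ^ 3 - 2308832035157664 * k ^ 2 + 331207813693440 * k - 34177773547008)
      * w ^ 2 * t ^ 1
    + (188116992 * k ^ 14 + 44582047488 * k ^ 13 - 5570275831344 * k ^ 12 + 197510470201485 * k ^
      11 - 4844866506399837 * k ^ 10 + 26289490479921603 * k ^ 9 - 56483168504250213 * k ^ 8 +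
      71468790850853505 * k ^ 7 - 58940295829972107 * k ^ 6 + 31399145961728625 * k ^ 5 -
      8208442594854855 * k ^ 4 + 536916197182302 * k ^ 3 + 76316865711300 * k ^ 2 - 34284810972384
      * k + 9695982502080) * w ^ 2
    + (2149908480 * k ^ 14 + 534386626560 * k ^ 13 - 58517705173248 * k ^ 12 + 1302660295319664 *
      k ^ 11 - 16384741576803936 * k ^ 10 + 77397864277952160 * k ^ 9 - 164159466968052000 * k ^ 8
      + 205219119832942464 * k ^ 7 - 160658279956790880 * k ^ 6 + 76764615841081440 * k ^ 5 -
      7551931217800032 * k ^ 4 - 7516892137371120 * k ^ 3 + 2510262095275584 * k ^ 2 -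
      409218898804992 * k + 56207087612928) * w ^ 1 * t ^ 1
    + (5831626752 * k ^ 14 + 1480455532800 * k ^ 13 - 151570937805264 * k ^ 12 + 2555285375789235
      * k ^ 11 - 11744832953543913 * k ^ 10 + 19672859586486699 * k ^ 9 - 7229740137743709 * k ^ 8
      - 46087299238801755 * k ^ 7 + 102050987026946373 * k ^ 6 - 115934336867944647 * k ^ 5 +
      81282665506454865 * k ^ 4 - 32213498720790204 * k ^ 3 + 7079071841369280 * k ^ 2 -
      1012809414603456 * k + 95829532565760) * w ^ 1
    + (1289945088 * k ^ 14 + 336971280384 * k ^ 13 - 31540266508032 * k ^ 12 + 206048004624144 * k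
      ^ 11 + 11415087918552960 * k ^ 10 - 72419115576578400 * k ^ 9 + 148712245733143584 * k ^ 8 -
      178035341045949504 * k ^ 7 + 131969516997064608 * k ^ 6 - 51749495864187552 * k ^ 5 -
      3485016851566752 * k ^ 4 + 8872899008593968 * k ^ 3 - 2304896259116448 * k ^ 2 +
      400486367695104 * k - 64118163949056) * t ^ 1
    + (1209323520 * k ^ 14 + 347299239168 * k ^ 13 - 21926764967184 * k ^ 12 - 697986867589857 * k
      ^ 11 + 35528378861082168 * k ^ 10 - 202076772034072410 * k ^ 9 + 426251106411174414 * k ^ 8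
      - 558296117194095180 * k ^ 7 + 479245234092069366 * k ^ 6 - 272651428936036134 * k ^ 5 +
      82658220421156218 * k ^ 4 - 9995067139804227 * k ^ 3 + 514533291452154 * k ^ 2 -
      29240878280976 * k - 26380790656416)) * hF
    + ((161243136 * k ^ 13 + 42175157760 * k ^ 12 - 3849644949984 * k ^ 11 + 45951977769282 * k ^
      10 - 166415285891322 * k ^ 9 + 133898508220806 * k ^ 8 + 353294522749566 * k ^ 7 -
      1071022682467566 * k ^ 6 + 1326811316349618 * k ^ 5 - 1049524992578718 * k ^ 4 +
      454663255040586 * k ^ 3 - 102061526060412 * k ^ 2 + 14646690498528 * k - 1512844361280) * w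
      ^ 5
    + (8957952 * k ^ 14 + 2280358656 * k ^ 13 - 230668745328 * k ^ 12 + 3906926246889 * k ^ 11 -
      31181948366148 * k ^ 10 + 144151345225350 * k ^ 9 - 429121076170770 * k ^ 8 +
      867400175781624 * k ^ 7 - 1179139102470978 * k ^ 6 + 1072382601404586 * k ^ 5 -
      679149208045158 * k ^ 4 + 261657052116639 * k ^ 3 - 57781384214706 * k ^ 2 + 8654385288528 *
      k - 871659841248) * w ^ 4 * t ^ 1
    + (116453376 * k ^ 14 + 26133145344 * k ^ 13 - 3915072769968 * k ^ 12 + 135540074389077 * k ^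
      11 - 1347802277317308 * k ^ 10 + 4689834916645206 * k ^ 9 - 4371704118740322 * k ^ 8 -
      7153963426182528 * k ^ 7 + 24483461505725246 * k ^ 6 - 30942461312915910 * k ^ 5 +
      24662441951363754 * k ^ 4 - 10710698511368949 * k ^ 3 + 2408133829055814 * k ^ 2 -
      347491648451952 * k + 36124047822240) * w ^ 3 * t ^ 1
    + (107495424 * k ^ 14 + 26504340480 * k ^ 13 - 2985028345152 * k ^ 12 + 69525519972588 * k ^
      11 - 802019579090832 * k ^ 10 + 3580616313862488 * k ^ 9 - 7064850383534592 * k ^ 8 +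
      7651042812238896 * k ^ 7 - 4178678128748160 * k ^ 6 + 132091696139112 * k ^ 5 +
      2049222148719552 * k ^ 4 - 1319210495098524 * k ^ 3 + 330067609390224 * k ^ 2 -
      49802601930048 * k + 5718898950912) * w ^ 4
    + (10346434560 * k ^ 14 + 2730273474816 * k ^ 13 - 240671719749456 * k ^ 12 + 2406569969710395
      * k ^ 11 + 631047680470980 * k ^ 10 - 54811277188438014 * k ^ 9 + 180026443765044090 * k ^ 8
      - 311255421061080936 * k ^ 7 + 339225482505860810 * k ^ 6 - 253479151227330738 * k ^ 5 +
      119806742401437534 * k ^ 4 - 34282712124517395 * k ^ 3 + 6309100163560842 * k ^ 2 -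
      818803513881360 * k + 58995221461344) * w ^ 2 * t ^ 1
    + (- 71663616 * k ^ 15 - 18135373824 * k ^ 14 + 1873896716160 * k ^ 13 - 33735458410632 * k ^
      12 + 264206607989580 * k ^ 11 - 171635693037948 * k ^ 10 - 3505979332870092 * k ^ 9 +
      11465270973604524 * k ^ 8 - 21204898864103940 * k ^ 7 + 27041417407569588 * k ^ 6 -
      23480268644189508 * k ^ 5 + 14478346143901356 * k ^ 4 - 5522553775453752 * k ^ 3 +
      1190876993336952 * k ^ 2 - 165296688128640 * k + 15573839331456) * w ^ 3
    + (6449725440 * k ^ 15 + 1592974688256 * k ^ 14 - 178127609089536 * k ^ 13 + 4174883760215232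
      * k ^ 12 - 54077264870063481 * k ^ 11 + 274857295905580572 * k ^ 10 - 668176529276490750 * k
      ^ 9 + 994390987252164858 * k ^ 8 - 981595183102979760 * k ^ 7 + 654920617404172506 * k ^ 6 -
      263193948928197522 * k ^ 5 + 40273285310353422 * k ^ 4 + 7490727727970697 * k ^ 3 -
      3436125662850462 * k ^ 2 + 565007060431152 * k - 65707745400864) * w ^ 1 * t ^ 1
    + (- 1504935936 * k ^ 15 - 393383983104 * k ^ 14 + 36077405463936 * k ^ 13 - 409249661514408 *
      k ^ 12 + 1271976094894788 * k ^ 11 - 74861717530896 * k ^ 10 - 3359620266088248 * k ^ 9 +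
      1432140688602672 * k ^ 8 + 3101708717741648 * k ^ 7 + 4668076593582912 * k ^ 6 -
      10104961726723080 * k ^ 5 + 14526031875833400 * k ^ 4 - 8420363458840980 * k ^ 3 +
      2057748080676624 * k ^ 2 - 311465340227520 * k + 38493571431168) * w ^ 2
    + (3869835264 * k ^ 15 + 1000594280448 * k ^ 14 - 97311409986816 * k ^ 13 + 868724469245232 *
      k ^ 12 + 31638387616289280 * k ^ 11 - 240533545722865632 * k ^ 10 + 634580046987598368 * k ^
      9 - 934259845373669376 * k ^ 8 + 864852601833966240 * k ^ 7 - 493484174298914208 * k ^ 6 +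
      111131233043236704 * k ^ 5 + 50142513120745680 * k ^ 4 - 37239937674416928 * k ^ 3 +
      8896674657935232 * k ^ 2 - 1443010514222592 * k + 182612671395840) * t ^ 1
    + (5804752896 * k ^ 15 + 1460795627520 * k ^ 14 - 154524644286336 * k ^ 13 + 2767977478226952
      * k ^ 12 - 9787982042537532 * k ^ 11 + 268012916539722 * k ^ 10 + 42806487095212950 * k ^ 9
      - 111806667639003906 * k ^ 8 + 178895977842570870 * k ^ 7 - 210050937637282998 * k ^ 6 +
      171456683708708226 * k ^ 5 - 105195242943440766 * k ^ 4 + 40699064193346062 * k ^ 3 -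
      8700979665444444 * k ^ 2 + 1206857654902944 * k - 122157729336384) * w ^ 1
    + (- 1934917632 * k ^ 15 - 497717250048 * k ^ 14 + 48434425663104 * k ^ 13 - 733005570322584 *
      k ^ 12 + 5742289778278176 * k ^ 11 - 30352048190799984 * k ^ 10 + 97974778573372176 * k ^ 9
      - 181067494316286816 * k ^ 8 + 218968886189062800 * k ^ 7 - 162226828117811664 * k ^ 6 +
      72802624220292528 * k ^ 5 - 3139587926685576 * k ^ 4 - 9667082297430000 * k ^ 3 +
      2914191867201984 * k ^ 2 - 452973778958592 * k + 63884263984128)) * hw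
    + ((- 161243136 * k ^ 14 - 42175157760 * k ^ 13 + 3849644949984 * k ^ 12 - 45951977769282 * k
      ^ 11 + 166415285891322 * k ^ 10 - 133898508220806 * k ^ 9 - 353294522749566 * k ^ 8 +
      1071022682467566 * k ^ 7 - 1326811316349618 * k ^ 6 + 1049524992578718 * k ^ 5 -
      454663255040586 * k ^ 4 + 102061526060412 * k ^ 3 - 14646690498528 * k ^ 2 + 1512844361280 *
      k) * w ^ 3
    + (214990848 * k ^ 15 + 51342501888 * k ^ 14 - 6432047761536 * k ^ 13 + 171639535273272 * k ^
      12 - 1554997956786378 * k ^ 11 + 6423074210920338 * k ^ 10 - 14289563853853614 * k ^ 9 +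
      20657703585422250 * k ^ 8 - 20082890234594538 * k ^ 7 + 13414347634655574 * k ^ 6 -
      5536443483073818 * k ^ 5 + 1430909071710102 * k ^ 4 - 312291351124164 * k ^ 3 +
      62270493537312 * k ^ 2 - 6020347612608 * k) * w ^ 2
    + (429981696 * k ^ 15 + 104673669120 * k ^ 14 - 12551473075968 * k ^ 13 + 241063470150480 * k
      ^ 12 + 2331414214498458 * k ^ 11 - 25002869386821138 * k ^ 10 + 80479523393968878 * k ^ 9 -
      147845911915744794 * k ^ 8 + 182364966629383818 * k ^ 7 - 152530001032196502 * k ^ 6 +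
      87474179702377818 * k ^ 5 - 30871861763642478 * k ^ 4 + 6402592157153364 * k ^ 3 -
      946909655916192 * k ^ 2 + 98239388200128 * k) * w ^ 1
    + (- 644972544 * k ^ 15 - 155854927872 * k ^ 14 + 19025695995264 * k ^ 13 - 416552650373736 *
      k ^ 12 - 730464279942798 * k ^ 11 + 18413379890009478 * k ^ 10 - 66056061031894458 * k ^ 9 +
      127541502853072110 * k ^ 8 - 163353099077256846 * k ^ 7 + 140442464713890546 * k ^ 6 -
      82987261211882718 * k ^ 5 + 29895615946972962 * k ^ 4 - 6192362332089612 * k ^ 3 +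
      899285852877408 * k ^ 2 - 93731884948800 * k)) * ht
    + ((80621568 * k ^ 13 + 21087578880 * k ^ 12 - 1924822474992 * k ^ 11 + 22975988884641 * k ^
      10 - 83207642945661 * k ^ 9 + 66949254110403 * k ^ 8 + 176647261374783 * k ^ 7 -
      535511341233783 * k ^ 6 + 663405658174809 * k ^ 5 - 524762496289359 * k ^ 4 +
      227331627520293 * k ^ 3 - 51030763030206 * k ^ 2 + 7323345249264 * k - 756422180640) * w ^ 4
    + (- 26873856 * k ^ 14 - 6841075968 * k ^ 13 + 692006235984 * k ^ 12 - 11720778740667 * k ^ 11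
      + 93545845098444 * k ^ 10 - 432454035676050 * k ^ 9 + 1287363228512310 * k ^ 8 -
      2602200527344872 * k ^ 7 + 3537417307412934 * k ^ 6 - 3217147804213758 * k ^ 5 +
      2037447624135474 * k ^ 4 - 784971156349917 * k ^ 3 + 173344152644118 * k ^ 2 -
      25963155865584 * k + 2614979523744) * w ^ 3 * t ^ 1
    + (- 367276032 * k ^ 14 - 93709695744 * k ^ 13 + 9392298726384 * k ^ 12 - 158526270059985 * k
      ^ 11 + 1086047626416012 * k ^ 10 - 3323350833920190 * k ^ 9 + 4345445303723610 * k ^ 8 -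
      1181395147098336 * k ^ 7 - 4924497706813638 * k ^ 6 + 8111174055292398 * k ^ 5 -
      7071618250823298 * k ^ 4 + 3157646990462673 * k ^ 3 - 717545641163886 * k ^ 2 +
      108090741144240 * k - 11937275786016) * w ^ 2 * t ^ 1
    + (143327232 * k ^ 14 + 36485738496 * k ^ 13 - 3690699925248 * k ^ 12 + 62510819950224 * k ^
      11 - 498911173858368 * k ^ 10 + 2306421523605600 * k ^ 9 - 6865937218732320 * k ^ 8 +
      13878402812505984 * k ^ 7 - 18866225639535648 * k ^ 6 + 17158121622473376 * k ^ 5 -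
      10866387328722528 * k ^ 4 + 4186512833866224 * k ^ 3 - 924502147435296 * k ^ 2 +
      138470164616448 * k - 13946557459968) * w ^ 1 * t ^ 2
    + (26873856 * k ^ 14 + 6222977280 * k ^ 13 - 850906680912 * k ^ 12 + 27104097024747 * k ^ 11 -
      373273908563529 * k ^ 10 + 1767991738894443 * k ^ 9 - 3591307612225557 * k ^ 8 +
      4004025186530709 * k ^ 7 - 2310474283765683 * k ^ 6 + 240966680166009 * k ^ 5 +
      948833865186345 * k ^ 4 - 642594993205860 * k ^ 3 + 162592689612024 * k ^ 2 - 24649160238144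
      * k + 2859449475456) * w ^ 3
    + (- 10507677696 * k ^ 14 - 2762433642240 * k ^ 13 + 246791765472048 * k ^ 12 -
      2786935185907101 * k ^ 11 + 9060076597256676 * k ^ 10 - 1021208718835566 * k ^ 9 -
      47188307910976182 * k ^ 8 + 125611414225524600 * k ^ 7 - 172418420190382438 * k ^ 6 +
      153186983528761278 * k ^ 5 - 88608132648852402 * k ^ 4 + 30934293706628709 * k ^ 3 -
      6415038414381222 * k ^ 2 + 899202270831984 * k - 80963949917088) * w ^ 1 * t ^ 1
    + (2149908480 * k ^ 14 + 559898873856 * k ^ 13 - 51986551949568 * k ^ 12 + 662910708499056 * k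
      ^ 11 - 3656354920842816 * k ^ 10 + 9604678980522528 * k ^ 9 - 15327638321203296 * k ^ 8 +
      21720657431692032 * k ^ 7 - 19224288094947424 * k ^ 6 + 11220734664875232 * k ^ 5 -
      4356255180087840 * k ^ 4 + 1235517290428560 * k ^ 3 - 260175592500192 * k ^ 2 +
      16398973096704 * k + 3247273483776) * t ^ 2
    + (71663616 * k ^ 15 + 17517275136 * k ^ 14 - 2034063218304 * k ^ 13 + 48801932439480 * k ^ 12
      - 499382231957577 * k ^ 11 + 3095023975934157 * k ^ 10 - 10408728169999035 * k ^ 9 +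
      17786104258492437 * k ^ 8 - 16301968016969073 * k ^ 7 + 5430049446183531 * k ^ 6 +
      4532279151397191 * k ^ 5 - 7827703220478129 * k ^ 4 + 4135117595431374 * k ^ 3 -
      977461343065044 * k ^ 2 + 145739159728416 * k - 16418590114752) * w ^ 2
    + (1289945088 * k ^ 15 + 329168904192 * k ^ 14 - 33036581348352 * k ^ 13 + 537427987025184 * k
      ^ 12 - 3165380500118319 * k ^ 11 + 7958397788211933 * k ^ 10 - 8373415440855159 * k ^ 9 -
      574765565165079 * k ^ 8 + 27362378190721927 * k ^ 7 - 60218934640866945 * k ^ 6 +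
      67659134046005955 * k ^ 5 - 50467661653950429 * k ^ 4 + 21315446775788508 * k ^ 3 -
      4766363194194504 * k ^ 2 + 688480083834048 * k - 70792154423424) * w ^ 1
    + (- 2579890176 * k ^ 15 - 641828302848 * k ^ 14 + 69633799504128 * k ^ 13 - 1666027105394832
      * k ^ 12 + 29703757382462313 * k ^ 11 - 178143174849162492 * k ^ 10 + 492773927295548286 * k
      ^ 9 - 813528422367917274 * k ^ 8 + 901157057671733136 * k ^ 7 - 692407868181468378 * k ^ 6 +
      354597476258736018 * k ^ 5 - 105644552686374366 * k ^ 4 + 16886806100477991 * k ^ 3 -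
      2015084489933826 * k ^ 2 + 199434855051216 * k + 12137740132896) * t ^ 1
    + (- 1934917632 * k ^ 15 - 488069535744 * k ^ 14 + 51199546690944 * k ^ 13 - 897914108933064 *
      k ^ 12 + 3330391194772605 * k ^ 11 - 13664111857551234 * k ^ 10 + 66619382028377796 * k ^ 9
      - 135253862161510572 * k ^ 8 + 168724864113483414 * k ^ 7 - 127457165395340352 * k ^ 6 +
      56431631246991012 * k ^ 5 + 249817188797172 * k ^ 4 - 9305394817108203 * k ^ 3 +
      2670569333861346 * k ^ 2 - 385967444827536 * k + 51383106208224)) * hQ)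

/-! ### The pair (3, 6): compactness and critical points -/

/-- `16 (u - 1)² (gergonneSq 3 w u - k * gergonneSq 6 w u)` in terms of `τ = u - 1`. -/
def ratioPoly (k w τ : ℝ) : ℝ :=
  τ ^ 2 * (w * (w - 1) ^ 2 - 16 * (w + 3) * (1 + τ))
    - 4 * k * ((w + 3) ^ 2 * τ - 12 * τ ^ 3 - 3 * (w - 1) ^ 2)

theorem ratioPoly_eq (k w : ℝ) {u : ℝ} (hu : u - 1 ≠ 0) :
    ratioPoly k w (u - 1)
      = 16 * (u - 1) ^ 2 * (gergonneSq 3 w u - k * gergonneSq 6 w u) := by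
  simp only [ratioPoly, gergonneSq]
  field_simp
  ring

theorem gergonneSq_nine_le_three {w u : ℝ} (h : IsTriangleParam w u) :
    gergonneSq 9 w u ≤ gergonneSq 3 w u := by
  have := mul_gergonneSq_le_of_isoDist (i := 3) (j := 9) (a := 1) (b := 1) (by decide) (by decide)
    (by decide) (by decide) zero_le_one
    (fun t h0 h1 => by simp only [isoDist]; nlinarith) h
  linarith

theorem IsTriangleParam.sub_one_pos {w u : ℝ} (h : IsTriangleParam w u) : 0 < u - 1 := by
  linarith [h.three_le]

/-- Chaining through the mittenpunkt gives `3 D(7,6) ≤ D(7,9) ≤ D(7,3)`. This starting value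
explains the threshold `9` for the roots of `sextPoly`. -/
theorem ratioPoly_nine_nonneg {w u : ℝ} (h : IsTriangleParam w u) :
    0 ≤ ratioPoly 9 w (u - 1) := by
  rw [ratioPoly_eq _ _ h.sub_one_pos.ne']
  have := nine_mul_gergonneSq_six_le h
  have := gergonneSq_nine_le_three h
  exact mul_nonneg (by positivity) (by linarith)

/-- The bounds on the triangles with `D(7, 3) < 8 D(7, 6)`. -/
theorem bounds_of_ratioPoly_neg {w u : ℝ} (h : IsTriangleParam w u)
    (hneg : ratioPoly 64 w (u - 1) < 0) : 61 / 20 < u ∧ u < 9 ∧ w < 200 := by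
  have h93 := gergonneSq_nine_le_three h
  obtain ⟨hw, hu, -⟩ := h
  obtain ⟨τ, rfl⟩ : ∃ τ, u = τ + 1 := ⟨u - 1, by ring⟩
  simp only [add_sub_cancel_right] at hneg
  have hτ : 2 ≤ τ := by linarith
  simp only [gergonneSq] at h93
  -- Replacing the circumcenter by the nearer mittenpunkt gives a weaker condition that is only
  -- quadratic in `w`.
  have hH : τ ^ 2 * ((τ + 1) * (w ^ 2 + 6 * w - 27) - 4 * w ^ 2)
      < 64 * ((w + 3) ^ 2 * τ - 12 * τ ^ 3 - 3 * (w - 1) ^ 2) := by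
    have := mul_le_mul_of_nonneg_left h93 (sq_nonneg τ)
    simp only [ratioPoly] at hneg
    linarith
  have h8 : τ < 8 := by
    by_contra! h8
    have : 0 ≤ w ^ 2 * ((τ - 3) * (τ ^ 2 - 64)) + 6 * w * ((τ + 1) * (τ ^ 2 - 64))
        + (τ ^ 2 * (741 * τ - 27) - 576 * τ + 192) := by
      have h1 : 0 ≤ τ ^ 2 - 64 := by nlinarith
      have h2 : 0 ≤ τ - 3 := by linarith
      have h3 : 0 ≤ τ ^ 2 * (741 * τ - 27) - 576 * τ := by nlinarith
      positivity
    linarith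
  refine ⟨?_, by linarith, ?_⟩
  -- Near the equilateral triangle, multiplying by `3 - τ > 0` completes the square in `w`. The
  -- remainder is nonnegative while `128 + 67 τ - 61 τ ^ 2 ≥ 0`, which still holds at `τ = 41 / 20`.
  · by_contra! h2
    have h2' : τ ≤ 41 / 20 := by linarith
    have h3 : 0 < 64 - τ ^ 2 := by nlinarith
    have h4 : 0 ≤ 12 * τ * ((τ - 2) * (128 + 67 * τ - 61 * τ ^ 2)) :=
      mul_nonneg (by linarith) (mul_nonneg (by linarith) (by nlinarith))
    have h5 : 0 ≤ (64 - τ ^ 2) * (w * (3 - τ) - 3 * (τ + 1)) ^ 2 := by positivity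
    have h6 := mul_lt_mul_of_pos_left hH (show 0 < 3 - τ by linarith)
    linarith
  -- For `w ≥ 200` the cubic term in `w` dominates, uniformly for `2 ≤ τ ≤ 8`.
  · by_contra! h2
    obtain ⟨v, rfl⟩ : ∃ v, w = v + 200 := ⟨w - 200, by ring⟩
    have hv : 0 ≤ v := by linarith
    have h3 : 0 ≤ 2 * ((v + 200) * (v + 200 - 1) ^ 2 - 144 * (v + 200 + 3))
        - 256 * (v + 200 + 3) ^ 2 := by
      have h30 : 0 ≤ v ^ 2 * v := by positivity
      nlinarith
    have h4 : 0 ≤ τ * (τ - 2) * ((v + 200) * (v + 200 - 1) ^ 2 - 144 * (v + 200 + 3)) :=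
      mul_nonneg (mul_nonneg (by linarith) (by linarith)) (by nlinarith)
    have h5 : 0 ≤ 16 * τ ^ 2 * ((v + 203) * (8 - τ)) :=
      mul_nonneg (by positivity) (mul_nonneg (by linarith) (by linarith))
    have h6 := mul_nonneg (show 0 ≤ τ by linarith) h3
    have h7 : 0 ≤ 3072 * τ ^ 3 + 768 * (v + 200 - 1) ^ 2 := by positivity
    simp only [ratioPoly] at hneg
    linarith

/-- Converse of Blundon's inequality: normalizing `x + y + z = 1`, the tangent lengths must be the
roots of `s ^ 3 - s ^ 2 + q s - r`. A positive discriminant separates the signs at the critical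
points, so the intermediate value theorem gives three roots in `(0, 1)`. -/
theorem isRealized_of_blundon_pos {w u : ℝ} (hw : 1 < w) (hu : 3 ≤ u)
    (hB : 0 < w ^ 2 * (u - 4) - 4 * w * u ^ 2 + 18 * w * u - 27 * u) : IsRealized w u := by
  have hu0 : 0 < u := by linarith
  have hw0 : 0 < w := by linarith
  obtain ⟨q, hq⟩ : ∃ q, q = 1 / u := ⟨_, rfl⟩
  obtain ⟨r, hr⟩ : ∃ r, r = 1 / (u * w) := ⟨_, rfl⟩
  have hq0 : 0 < q := by rw [hq]; positivity
  have hr0 : 0 < r := by rw [hr]; positivity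
  have hq3 : 3 * q ≤ 1 := by rw [hq]; field_simp; linarith
  have hrq : r < q := by
    rw [hr, hq]
    exact one_div_lt_one_div_of_lt hu0 (by nlinarith)
  have hΔ : 0 < q ^ 2 - 4 * q ^ 3 - 4 * r + 18 * q * r - 27 * r ^ 2 := by
    have : 0 < (w ^ 2 * (u - 4) - 4 * w * u ^ 2 + 18 * w * u - 27 * u) / (u ^ 3 * w ^ 2) := by
      positivity
    refine this.trans_eq ?_
    rw [hq, hr]
    field_simp
  -- The critical points of the cubic are `(1 ± e) / 3`.
  obtain ⟨e, he0, he⟩ : ∃ e : ℝ, 0 ≤ e ∧ e ^ 2 = 1 - 3 * q :=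
    ⟨√(1 - 3 * q), Real.sqrt_nonneg _, Real.sq_sqrt (by linarith)⟩
  have he1 : e < 1 := by nlinarith
  set f : ℝ → ℝ := fun s => s ^ 3 - s ^ 2 + q * s - r with hf
  have hfc : Continuous f := by fun_prop
  have hc : (-2 / 27 + q / 3 - r) ^ 2 < (2 / 27 * e ^ 3) ^ 2 := by
    have : (2 / 27 * e ^ 3) ^ 2 = 4 / 729 * (1 - 3 * q) ^ 3 := by rw [← he]; ring
    rw [this]
    linarith
  obtain ⟨hc1, hc2⟩ := abs_lt_of_sq_lt_sq' hc (by positivity)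
  have hfm : 0 < f ((1 - e) / 3) := by
    have : f ((1 - e) / 3) = -2 / 27 + q / 3 - r + 2 / 27 * e ^ 3 := by
      rw [hf]
      linear_combination (-(1 : ℝ) / 9 * e) * he
    rw [this]; linarith
  have hfp : f ((1 + e) / 3) < 0 := by
    have : f ((1 + e) / 3) = -2 / 27 + q / 3 - r - 2 / 27 * e ^ 3 := by
      rw [hf]
      linear_combination ((1 : ℝ) / 9 * e) * he
    rw [this]; linarith
  have hf0 : f 0 < 0 := by simp [hf, hr0]
  have hf1 : 0 < f 1 := by simp only [hf]; linarith
  obtain ⟨x, ⟨hx0, hx1⟩, hx⟩ := intermediate_value_Ioo (show (0 : ℝ) ≤ (1 - e) / 3 by linarith)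
    hfc.continuousOn ⟨hf0, hfm⟩
  obtain ⟨y, ⟨hy0, hy1⟩, hy⟩ := intermediate_value_Ioo'
    (show (1 - e) / 3 ≤ (1 + e) / 3 by linarith) hfc.continuousOn ⟨hfp, hfm⟩
  obtain ⟨z, ⟨hz0, hz1⟩, hz⟩ := intermediate_value_Ioo (show (1 + e) / 3 ≤ 1 by linarith)
    hfc.continuousOn ⟨hfp, hf1⟩
  simp only [hf] at hx hy hz
  have hxy : x < y := hx1.trans hy0
  have hyz : y < z := hy1.trans hz0
  -- Vieta's formulas by divided differences of the three root equations.
  have e1 : x ^ 2 + x * y + y ^ 2 - (x + y) + q = 0 := by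
    have : (y - x) * (x ^ 2 + x * y + y ^ 2 - (x + y) + q) = 0 := by linear_combination hy - hx
    exact (mul_eq_zero.1 this).resolve_left (by linarith)
  have e2 : y ^ 2 + y * z + z ^ 2 - (y + z) + q = 0 := by
    have : (z - y) * (y ^ 2 + y * z + z ^ 2 - (y + z) + q) = 0 := by linear_combination hz - hy
    exact (mul_eq_zero.1 this).resolve_left (by linarith)
  have e3 : x + y + z = 1 := by
    have : (z - x) * (x + y + z - 1) = 0 := by linear_combination e2 - e1
    linarith [(mul_eq_zero.1 this).resolve_left (by linarith)]
  have e4 : x * y + y * z + z * x = q := by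
    linear_combination (x + y) * e3 - e1
  have e5 : x * y * z = r := by
    linear_combination (-x ^ 2) * e3 + x * e4 + hx
  refine ⟨x, y, z, hx0, hx0.trans hxy, (hx0.trans hxy).trans hyz, ?_, ?_⟩
  · rw [e3, e4, e5, hq, hr]; field_simp
  · rw [e3, e4, hq]; field_simp

/-- First-order condition at a local minimum; `ratioPoly` is cubic in each of its two variables
separately. -/
theorem cubic_deriv_eq_zero {a b c d s : ℝ} (h0 : a * s ^ 3 + b * s ^ 2 + c * s + d = 0)
    (h : ∀ᶠ v in nhds s, 0 ≤ a * v ^ 3 + b * v ^ 2 + c * v + d) :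
    3 * a * s ^ 2 + 2 * b * s + c = 0 := by
  have hmin : IsLocalMin (fun v => a * v ^ 3 + b * v ^ 2 + c * v + d) s := by
    filter_upwards [h] with v hv
    rw [h0]
    exact hv
  have hd : HasDerivAt (fun v => a * v ^ 3 + b * v ^ 2 + c * v + d)
      (a * (3 * s ^ 2) + b * (2 * s) + c) s := by
    simpa using ((((hasDerivAt_pow 3 s).const_mul a).add ((hasDerivAt_pow 2 s).const_mul b)).add
      ((hasDerivAt_id s).const_mul c)).add_const d
  have := hmin.hasDerivAt_eq_zero hd
  linarith

/-- Strict inequalities leave room to move `w` and `u` independently through realized parameters. A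
zero of the nonnegative function is then critical in both directions, and elimination applies. -/
theorem sextPoly_eq_zero_of_minimum {k w u : ℝ} (hw : 9 ≤ w) (hu : 3 < u)
    (hB : 0 < w ^ 2 * (u - 4) - 4 * w * u ^ 2 + 18 * w * u - 27 * u)
    (h0 : ratioPoly k w (u - 1) = 0)
    (h : ∀ w' u' : ℝ, IsRealized w' u' → 0 ≤ ratioPoly k w' (u' - 1)) : sextPoly k = 0 := by
  obtain ⟨τ, rfl⟩ : ∃ τ, u = τ + 1 := ⟨u - 1, by ring⟩
  simp only [add_sub_cancel_right] at h0
  have hw' : ∀ᶠ v in nhds w, 0 ≤ ratioPoly k v τ := by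
    have h1 : ∀ᶠ v in nhds w, 1 < v := lt_mem_nhds (by linarith)
    have h2 : ∀ᶠ v in nhds w, 0 < v ^ 2 * (τ + 1 - 4) - 4 * v * (τ + 1) ^ 2 + 18 * v * (τ + 1)
        - 27 * (τ + 1) := by
      have hc : Continuous (fun v => v ^ 2 * (τ + 1 - 4) - 4 * v * (τ + 1) ^ 2
        + 18 * v * (τ + 1) - 27 * (τ + 1)) := by
        fun_prop
      exact (hc.tendsto _).eventually (lt_mem_nhds hB)
    filter_upwards [h1, h2] with v hv1 hv2
    simpa using h v (τ + 1) (isRealized_of_blundon_pos hv1 hu.le hv2)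
  have hτ' : ∀ᶠ v in nhds τ, 0 ≤ ratioPoly k w v := by
    have h1 : ∀ᶠ v in nhds τ, 2 < v := lt_mem_nhds (by linarith)
    have h2 : ∀ᶠ v in nhds τ, 0 < w ^ 2 * (v + 1 - 4) - 4 * w * (v + 1) ^ 2 + 18 * w * (v + 1)
        - 27 * (v + 1) := by
      have hc : Continuous (fun v => w ^ 2 * (v + 1 - 4) - 4 * w * (v + 1) ^ 2
        + 18 * w * (v + 1) - 27 * (v + 1)) := by
        fun_prop
      exact (hc.tendsto _).eventually (lt_mem_nhds hB)
    filter_upwards [h1, h2] with v hv1 hv2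
    simpa using h w (v + 1) (isRealized_of_blundon_pos (by linarith) (by linarith) hv2)
  have hFw := cubic_deriv_eq_zero (a := τ ^ 2) (b := -2 * τ ^ 2 - 4 * k * τ + 12 * k)
    (c := -16 * τ ^ 3 - 15 * τ ^ 2 - 24 * k * τ - 24 * k)
    (d := 48 * k * τ ^ 3 - 48 * τ ^ 3 - 48 * τ ^ 2 - 36 * k * τ + 12 * k) (s := w)
    (by rw [← h0, ratioPoly]; ring)
    (hw'.mono fun v hv => hv.trans_eq (by rw [ratioPoly]; ring))
  have hFτ := cubic_deriv_eq_zero (a := -16 * w + 48 * k - 48)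
    (b := w ^ 3 - 2 * w ^ 2 - 15 * w - 48) (c := -4 * k * (w ^ 2 + 6 * w + 9))
    (d := 4 * k * (3 * w ^ 2 - 6 * w + 3)) (s := τ)
    (by rw [← h0, ratioPoly]; ring)
    (hτ'.mono fun v hv => hv.trans_eq (by rw [ratioPoly]; ring))
  have := elimination_certificate (w := w) (t := τ) (k := k) h0 (by linarith) (by linarith)
  exact (mul_eq_zero.1 this).resolve_left (pow_ne_zero 2 (by linarith))

/-- Isosceles triangles satisfy `8 D(7,6) ≤ D(7,3)`, so for `k < 64` no zero of `ratioPoly k` lies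
on the Blundon boundary away from the equilateral triangle. -/
theorem ratioPoly_isosceles_pos {k t : ℝ} (hk0 : 0 ≤ k) (hk : k < 64) (h0 : 0 < t)
    (h1 : t < 1 / 2) (h3 : t ≠ 1 / 3)
    (hu : 1 / (t * (2 - 3 * t)) - 1 ≠ 0) :
    0 < ratioPoly k ((2 - 3 * t) / (t * (1 - 2 * t))) (1 / (t * (2 - 3 * t)) - 1) := by
  have h2 : 0 < 1 - 2 * t := by linarith
  have h4 : 0 < 2 - 3 * t := by linarith
  have h5 := isoDist_denom_pos t
  have h6 : 1 - 3 * t ≠ 0 := fun h => h3 (by linarith)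
  have i3 : 0 < isoDist 3 t := by simp only [isoDist]; nlinarith
  have i6 : 8 * isoDist 6 t ≤ isoDist 3 t := by
    simp only [isoDist]
    rw [← mul_div_assoc, div_le_iff₀ h5]
    rcases abs_cases (1 - 3 * t) with ⟨h, h'⟩ | ⟨h, h'⟩ <;> rw [h]
    · have h7 : 0 ≤ t * (1 - 3 * t) := mul_nonneg h0.le h'
      have h8 : 0 ≤ (1 - 2 * t) * (5 * t - 1) ^ 2 := by positivity
      have h9 : 0 ≤ t ^ 2 * (1 - 3 * t) := by positivity
      have h10 : 0 ≤ t ^ 3 * (1 - 3 * t) := by positivity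
      nlinarith
    · have h7 : 0 ≤ t * (3 * t - 1) := mul_nonneg h0.le (by linarith)
      have h8 : 0 ≤ (1 - 2 * t) * (3 * t - 1) := mul_nonneg h2.le (by linarith)
      have h9 : 0 ≤ t * ((1 - 2 * t) * (3 * t - 1)) := by positivity
      have h10 : 0 ≤ t ^ 2 * ((1 - 2 * t) * (3 * t - 1)) := by positivity
      nlinarith [sq_nonneg (9 * t - 4), mul_nonneg h0.le (sq_nonneg (9 * t - 4))]
  have i6' := isoDist_nonneg 6 h0 h1
  rw [ratioPoly_eq _ _ hu, gergonneSq_isosceles (by decide) h0 h1,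
    gergonneSq_isosceles (by decide) h0 h1]
  have hsq : (8 * isoDist 6 t) ^ 2 ≤ isoDist 3 t ^ 2 := pow_le_pow_left₀ (by positivity) i6 2
  have hd : 0 < isoDist 3 t ^ 2 - k * isoDist 6 t ^ 2 := by
    nlinarith [pow_pos i3 2, mul_nonneg hk0 (sub_nonneg.2 hsq)]
  have := mul_pos (show 0 < (1 - 3 * t) ^ 2 / (t ^ 3 * (1 - 2 * t) ^ 3 * (2 - 3 * t)) by
    positivity) hd
  refine mul_pos (by positivity) (this.trans_eq ?_)
  ring

/-- `ratioPoly` is affine in its first argument and nonnegative at `9`; a negative value later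
forces a negative slope. -/
theorem ratioPoly_neg_of_le {k l w u : ℝ} (h : IsTriangleParam w u) (hk : 9 ≤ k) (hkl : k ≤ l)
    (hneg : ratioPoly k w (u - 1) < 0) : ratioPoly l w (u - 1) < 0 := by
  have h9 := ratioPoly_nine_nonneg h
  simp only [ratioPoly] at *
  generalize (w + 3) ^ 2 * (u - 1) - 12 * (u - 1) ^ 3 - 3 * (w - 1) ^ 2 = B at *
  have hB : 0 < B := by
    by_contra! hB
    nlinarith
  nlinarith

theorem exists_realized_ratioPoly_neg : ∃ w u : ℝ, IsRealized w u ∧ ratioPoly 64 w (u - 1) < 0 :=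
  -- A nearly extremal scalene triangle, with ratio just below `8`.
  ⟨_, _, ⟨11, 31, 80, by norm_num, by norm_num, by norm_num, rfl, rfl⟩, by norm_num [ratioPoly]⟩

/-- A compact set of triangles (given by their tangent lengths, of sum `1`) that contains, up to
similarity, all triangles with `D(7, 3) < 8 D(7, 6)`. -/
def compactTriangles : Set (ℝ × ℝ × ℝ) :=
  Set.Icc (0, 0, 0) (1, 1, 1) ∩ {P | P.1 + P.2.1 + P.2.2 = 1 ∧
    1 / 1800 ≤ P.1 * P.2.1 * P.2.2 ∧
    61 / 20 * (P.1 * P.2.1 + P.2.1 * P.2.2 + P.2.2 * P.1) ≤ 1}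

theorem isCompact_compactTriangles : IsCompact compactTriangles := by
  have h1 : IsClosed {P : ℝ × ℝ × ℝ | P.1 + P.2.1 + P.2.2 = 1} :=
    isClosed_eq (by fun_prop) (by fun_prop)
  have h2 : IsClosed {P : ℝ × ℝ × ℝ | 1 / 1800 ≤ P.1 * P.2.1 * P.2.2} :=
    isClosed_le (by fun_prop) (by fun_prop)
  have h3 : IsClosed {P : ℝ × ℝ × ℝ |
      61 / 20 * (P.1 * P.2.1 + P.2.1 * P.2.2 + P.2.2 * P.1) ≤ 1} :=
    isClosed_le (by fun_prop) (by fun_prop)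
  exact isCompact_Icc.inter_right (h1.inter (h2.inter h3))

theorem pos_of_mem_compactTriangles {x y z : ℝ} (h : (x, y, z) ∈ compactTriangles) :
    0 < x ∧ 0 < y ∧ 0 < z := by
  obtain ⟨⟨⟨hx, hy, hz⟩, -⟩, -, hr, -⟩ := h
  simp only at hx hy hz hr
  have hr0 : x * y * z ≠ 0 := by linarith
  simp only [ne_eq, mul_eq_zero, not_or] at hr0
  exact ⟨lt_of_le_of_ne hx (Ne.symm hr0.1.1), lt_of_le_of_ne hy (Ne.symm hr0.1.2),
    lt_of_le_of_ne hz (Ne.symm hr0.2)⟩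

/-- The value of `ratioPoly` at the triangle with tangent lengths `x, y, z`. -/
noncomputable def ratioPolyTangent (k : ℝ) (P : ℝ × ℝ × ℝ) : ℝ :=
  ratioPoly k ((P.1 + P.2.1 + P.2.2) * (P.1 * P.2.1 + P.2.1 * P.2.2 + P.2.2 * P.1)
    / (P.1 * P.2.1 * P.2.2))
    ((P.1 + P.2.1 + P.2.2) ^ 2 / (P.1 * P.2.1 + P.2.1 * P.2.2 + P.2.2 * P.1) - 1)

theorem continuousOn_ratioPolyTangent (k : ℝ) :
    ContinuousOn (ratioPolyTangent k) compactTriangles := by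
  have h1 : ∀ P ∈ compactTriangles, P.1 * P.2.1 * P.2.2 ≠ 0 := fun ⟨x, y, z⟩ h => by
    obtain ⟨hx, hy, hz⟩ := pos_of_mem_compactTriangles h
    positivity
  have h2 : ∀ P ∈ compactTriangles, P.1 * P.2.1 + P.2.1 * P.2.2 + P.2.2 * P.1 ≠ 0 :=
    fun ⟨x, y, z⟩ h => by
    obtain ⟨hx, hy, hz⟩ := pos_of_mem_compactTriangles h
    positivity
  have hw : ContinuousOn (fun P : ℝ × ℝ × ℝ => (P.1 + P.2.1 + P.2.2)
      * (P.1 * P.2.1 + P.2.1 * P.2.2 + P.2.2 * P.1) / (P.1 * P.2.1 * P.2.2)) compactTriangles :=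
    ContinuousOn.div (by fun_prop) (by fun_prop) h1
  have hu : ContinuousOn (fun P : ℝ × ℝ × ℝ => (P.1 + P.2.1 + P.2.2) ^ 2
      / (P.1 * P.2.1 + P.2.1 * P.2.2 + P.2.2 * P.1)) compactTriangles :=
    ContinuousOn.div (by fun_prop) (by fun_prop) h2
  unfold ratioPolyTangent ratioPoly
  fun_prop

theorem ratioPolyTangent_nonneg {k : ℝ}
    (h : ∀ w u : ℝ, IsRealized w u → 0 ≤ ratioPoly k w (u - 1)) {P : ℝ × ℝ × ℝ}
    (hP : P ∈ compactTriangles) : 0 ≤ ratioPolyTangent k P := by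
  obtain ⟨x, y, z⟩ := P
  obtain ⟨hx, hy, hz⟩ := pos_of_mem_compactTriangles hP
  exact h _ _ ⟨x, y, z, hx, hy, hz, rfl, rfl⟩

theorem exists_mem_compactTriangles {w u : ℝ} (h : IsRealized w u)
    (hneg : ratioPoly 64 w (u - 1) < 0) :
    ∃ P ∈ compactTriangles, ∀ k, ratioPolyTangent k P = ratioPoly k w (u - 1) := by
  obtain ⟨hu1, hu2, hw⟩ := bounds_of_ratioPoly_neg h.isTriangleParam hneg
  obtain ⟨x, y, z, hx, hy, hz, rfl, rfl⟩ := h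
  obtain ⟨p, hp⟩ : ∃ p, p = x + y + z := ⟨_, rfl⟩
  have hp0 : 0 < p := by rw [hp]; positivity
  obtain ⟨q, hq⟩ : ∃ q, q = x * y + y * z + z * x := ⟨_, rfl⟩
  have hq0 : 0 < q := by rw [hq]; positivity
  obtain ⟨r, hr⟩ : ∃ r, r = x * y * z := ⟨_, rfl⟩
  have hr0 : 0 < r := by rw [hr]; positivity
  have e1 : x / p + y / p + z / p = 1 := by rw [← add_div, ← add_div, ← hp, div_self hp0.ne']
  have e2 : x / p * (y / p) + y / p * (z / p) + z / p * (x / p) = q / p ^ 2 := by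
    rw [hq]; field_simp
  have e3 : x / p * (y / p) * (z / p) = r / p ^ 3 := by rw [hr]; field_simp
  simp only [← hp, ← hq, ← hr] at hu1 hu2 hw ⊢
  refine ⟨(x / p, y / p, z / p), ⟨⟨⟨?_, ?_, ?_⟩, ?_, ?_, ?_⟩, ?_, ?_, ?_⟩, fun k => ?_⟩
  · exact div_nonneg hx.le hp0.le
  · exact div_nonneg hy.le hp0.le
  · exact div_nonneg hz.le hp0.le
  · exact (div_le_one hp0).2 (by linarith)
  · exact (div_le_one hp0).2 (by linarith)
  · exact (div_le_one hp0).2 (by linarith)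
  · exact e1
  · simp only [e3]
    -- `p ^ 3 / r` equals `u * w`, which explains the bound `1 / 1800` in `compactTriangles`.
    have : p ^ 3 / r < 9 * 200 := by
      have := mul_lt_mul'' hu2 hw (by positivity) (by positivity)
      refine lt_of_eq_of_lt ?_ this
      field_simp
    rw [div_le_div_iff₀ (by norm_num) (by positivity)]
    rw [div_lt_iff₀ hr0] at this
    linarith
  · simp only [e2]
    rw [lt_div_iff₀ hq0] at hu1
    rw [← mul_div_assoc, div_le_one (by positivity)]
    exact hu1.le
  · simp only [ratioPolyTangent, e1, e2, e3]
    congr 1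
    · field_simp
    · field_simp

theorem ratioPoly_convex (k w τ s : ℝ) :
    ratioPoly (k + s * (64 - k)) w τ = (1 - s) * ratioPoly k w τ + s * ratioPoly 64 w τ := by
  simp only [ratioPoly]
  ring

/-- Take the largest admissible `k` in `[9, 64]`. Maximality forces equality at some triangle of the
compact set; that triangle is scalene, hence an interior critical point. -/
theorem exists_greatest_ratio : ∃ k : ℝ, 9 ≤ k ∧ sextPoly k = 0 ∧
    (∀ w u : ℝ, IsRealized w u → 0 ≤ ratioPoly k w (u - 1)) ∧
    ∀ l, k < l → ∃ w u : ℝ, IsRealized w u ∧ ratioPoly l w (u - 1) < 0 := by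
  set S : Set ℝ := Set.Icc 9 64 ∩ {k | ∀ w u : ℝ, IsRealized w u → 0 ≤ ratioPoly k w (u - 1)}
  have hcl : IsClosed {k | ∀ w u : ℝ, IsRealized w u → 0 ≤ ratioPoly k w (u - 1)} := by
    simp only [Set.ofPred_forall]
    refine isClosed_iInter fun w => isClosed_iInter fun u => isClosed_iInter fun _ =>
      isClosed_le continuous_const ?_
    unfold ratioPoly
    fun_prop
  obtain ⟨k, ⟨⟨hk9, hk64⟩, hk⟩, hmax⟩ := ((isCompact_Icc (a := (9 : ℝ)) (b := 64)).inter_right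
    hcl).exists_isGreatest
    ⟨9, ⟨by norm_num, by norm_num⟩, fun w u h => ratioPoly_nine_nonneg h.isTriangleParam⟩
  obtain ⟨w₀, u₀, hr₀, hneg₀⟩ := exists_realized_ratioPoly_neg
  have hk64' : k < 64 := by
    refine lt_of_le_of_ne hk64 ?_
    rintro rfl
    exact absurd (hk w₀ u₀ hr₀) (not_le.2 hneg₀)
  refine ⟨k, hk9, ?_, hk, fun l hl => ?_⟩
  · obtain ⟨P₀, hP₀, -⟩ := exists_mem_compactTriangles hr₀ hneg₀
    obtain ⟨⟨x, y, z⟩, hP, hPmin⟩ := isCompact_compactTriangles.exists_isMinOn ⟨P₀, hP₀⟩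
      (continuousOn_ratioPolyTangent k)
    -- If the minimum `δ` were positive, `k` could be increased slightly towards `64`: triangles
    -- outside the compact set satisfy the inequality even at `64`, and the others have a margin of
    -- `δ`.
    have hzero : ratioPolyTangent k (x, y, z) = 0 := by
      refine le_antisymm ?_ (ratioPolyTangent_nonneg hk hP)
      by_contra! hδ
      obtain ⟨Q, hQ, hQmin⟩ := isCompact_compactTriangles.exists_isMinOn ⟨P₀, hP₀⟩
        (continuousOn_ratioPolyTangent 64)
      set δ := ratioPolyTangent k (x, y, z)
      set m := ratioPolyTangent 64 Q
      have hden : 0 < δ + |m| := by positivity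
      -- Small enough that the margin `δ` absorbs the possibly negative minimum `m` at `64`.
      set s := δ / (δ + |m|) with hs
      have hs0 : 0 < s := by positivity
      have hs1 : s ≤ 1 := (div_le_one hden).2 (by linarith [abs_nonneg m])
      have hsm : 0 ≤ (1 - s) * δ + s * m := by
        have : (1 - s) * δ + s * m = δ * (|m| + m) / (δ + |m|) := by
          rw [hs]; field_simp; ring
        rw [this]
        have : 0 ≤ |m| + m := by linarith [neg_abs_le m]
        positivity
      have hmem : k + s * (64 - k) ∈ S := by
        refine ⟨⟨by nlinarith, by nlinarith⟩, fun w u h => ?_⟩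
        rw [ratioPoly_convex]
        rcases le_or_gt 0 (ratioPoly 64 w (u - 1)) with h64 | h64
        · exact add_nonneg (mul_nonneg (by linarith) (hk w u h)) (mul_nonneg hs0.le h64)
        · obtain ⟨R, hR, hRk⟩ := exists_mem_compactTriangles h h64
          rw [← hRk, ← hRk]
          have h1 : δ ≤ ratioPolyTangent k R := hPmin hR
          have h2 : m ≤ ratioPolyTangent 64 R := hQmin hR
          nlinarith
      have := hmax hmem
      nlinarith
    obtain ⟨hx, hy, hz⟩ := pos_of_mem_compactTriangles hP
    obtain ⟨-, hsum, -, hq⟩ := hP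
    simp only at hsum hq
    have hq0 : 0 < x * y + y * z + z * x := by positivity
    obtain ⟨w, hw⟩ : ∃ w, w = (x + y + z) * (x * y + y * z + z * x) / (x * y * z) := ⟨_, rfl⟩
    obtain ⟨u, hu⟩ : ∃ u, u = (x + y + z) ^ 2 / (x * y + y * z + z * x) := ⟨_, rfl⟩
    have hreal : IsRealized w u := ⟨x, y, z, hx, hy, hz, hw, hu⟩
    have hparam := hreal.isTriangleParam
    have hu3 : 3 < u := by
      rw [hu, hsum, lt_div_iff₀ hq0]
      linarith
    simp only [ratioPolyTangent, ← hw, ← hu] at hzero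
    -- Excludes a repeated tangent length. The equilateral case is ruled out by `3 < u`, the other
    -- cases by strict positivity on isosceles triangles.
    have iso : ∀ t s : ℝ, 0 < t → 0 < s → t + t + s = 1 → x * y + y * z + z * x = t * t + 2 * t * s →
        x * y * z = t * t * s → False := by
      intro t s ht hs hts h1 h2
      obtain rfl : s = 1 - 2 * t := by linarith
      have h23 : 0 < 2 - 3 * t := by linarith
      have hw' : w = (2 - 3 * t) / (t * (1 - 2 * t)) := by
        rw [hw, h1, h2, hsum]
        field_simp
        ring
      have hu' : u = 1 / (t * (2 - 3 * t)) := by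
        rw [hu, h1, hsum]
        congr 1 <;> ring
      have h3 : t ≠ 1 / 3 := by
        rintro rfl
        rw [hu'] at hu3
        norm_num at hu3
      have := ratioPoly_isosceles_pos (by linarith) hk64' ht (by linarith) h3
        (by rw [← hu']; linarith)
      rw [← hw', ← hu', hzero] at this
      exact lt_irrefl _ this
    refine sextPoly_eq_zero_of_minimum hparam.nine_le hu3 ?_ hzero hk
    rw [blundon_eq hx hy hz hw hu]
    refine mul_pos (by positivity) (even_two.pow_pos ?_)
    simp only [ne_eq, mul_eq_zero, not_or, sub_eq_zero]
    refine ⟨⟨?_, ?_⟩, ?_⟩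
    · rintro rfl
      exact iso x z hx hz hsum (by ring) rfl
    · rintro rfl
      exact iso y x hy hx (by linarith) (by ring) (by ring)
    · rintro rfl
      exact iso z y hz hy (by linarith) (by ring) (by ring)
  · rcases le_or_gt l 64 with hl64 | hl64
    · by_contra! hcon
      exact absurd (hmax ⟨⟨by linarith, hl64⟩, hcon⟩) (not_le.2 hl)
    · exact ⟨w₀, u₀, hr₀, ratioPoly_neg_of_le hr₀.isTriangleParam (by norm_num) hl64.le hneg₀⟩

theorem bestBounds_3_6 {k : ℝ} (hk9 : 9 ≤ k)
    (hk : ∀ w u : ℝ, IsRealized w u → 0 ≤ ratioPoly k w (u - 1))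
    (hmax : ∀ l, k < l → ∃ w u : ℝ, IsRealized w u ∧ ratioPoly l w (u - 1) < 0) :
    BestBoundsTop 7 3 6 √k := by
  have hk0 : 0 ≤ k := by linarith
  refine ⟨⟨fun T => ?_, fun q hq => ?_⟩, ?_⟩
  · simpa using mul_centerDist_le_of_gergonneSq (i := 3) (j := 6) (a := √k) (b := 1) (by decide)
      (by decide) zero_le_one (fun w u h => by
        have := hk w u h
        have hτ := h.isTriangleParam.sub_one_pos
        rw [ratioPoly_eq _ _ hτ.ne'] at this
        rw [Real.sq_sqrt hk0]
        linarith [nonneg_of_mul_nonneg_right this (by positivity)]) T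
  · by_contra! hlt
    obtain ⟨w, u, h, hneg⟩ := hmax (q ^ 2) ((Real.sqrt_lt' (by linarith [Real.sqrt_nonneg k])).1 hlt)
    have hτ := h.isTriangleParam.sub_one_pos
    rw [ratioPoly_eq _ _ hτ.ne'] at hneg
    obtain ⟨x, y, z, hx, hy, hz, rfl, rfl⟩ := h
    obtain ⟨T, hT⟩ := exists_triangle hx hy hz
    have hD : 0 ≤ centerDist T 7 6 := dist_nonneg
    have hsq : (q * centerDist T 7 6) ^ 2 ≤ centerDist T 7 3 ^ 2 :=
      pow_le_pow_left₀ (mul_nonneg (by linarith [Real.sqrt_nonneg k]) hD) (hq T) 2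
    rw [mul_pow, hT.centerDist_sq (n := 6) (by decide), hT.centerDist_sq (n := 3) (by decide),
      mul_left_comm] at hsq
    have := le_of_mul_le_mul_left hsq (by positivity)
    exact absurd hneg (not_lt.2 (mul_nonneg (by positivity) (by linarith)))
  · exact no_upper_bound_of_isoDist (fun t => 1 / (1 - 2 * t + 3 * t ^ 2))
      (fun t => (1 - 3 / 2 * t - 1 / 2 * t ^ 2) * (1 - 2 * t + 3 * t ^ 2))
      (fun t => t * |1 - 3 * t| * (1 - 2 * t))
      (fun t _ _ => one_div_pos.2 (isoDist_denom_pos t))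
      (fun t _ _ => by
        have := isoDist_denom_pos t
        simp only [isoDist]
        generalize 1 - 2 * t + 3 * t ^ 2 = d at *
        field_simp)
      (fun t _ _ => by
        have := isoDist_denom_pos t
        simp only [isoDist]
        generalize 1 - 2 * t + 3 * t ^ 2 = d at *
        field_simp)
      0 ⟨by norm_num, by norm_num⟩ (by norm_num) (by norm_num)

/-! ### Assembly of all pairs -/

theorem mainTheorem9 :
    ∃ C₇ : ℝ, IsGreatest {x : ℝ | polyC7.IsRoot x} C₇ ∧
      |C₇ - 7.9776615835| < 0.00000000005 ∧
      -- the bounds that are different from `0` and `∞`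
      BestBounds 7 1 2 0 (3 / 4) ∧
      BestBounds 7 1 3 0 (2 / 17 * (5 - 2 * √2)) ∧
      BestBounds 7 1 4 0 1 ∧
      BestBounds 7 1 8 0 (1 / 2) ∧
      BestBounds 7 1 9 0 (1 / 2) ∧
      BestBounds 7 1 10 0 (2 / 3) ∧
      BestBounds 7 2 3 0 (2 / 3) ∧
      BestBoundsTop 7 2 6 2 ∧
      BestBounds 7 2 8 (1 / 3) (2 / 3) ∧
      (BestBounds 7 2 9 (2 / 3) (2 / 3) ∧
        ∀ t : PlaneTriangle, centerDist t 7 2 = 2 / 3 * centerDist t 7 9) ∧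
      BestBounds 7 2 10 (2 / 3) (8 / 9) ∧
      BestBoundsTop 7 3 4 (1 / 2) ∧
      BestBoundsTop 7 3 5 2 ∧
      BestBoundsTop 7 3 6 C₇ ∧
      BestBoundsTop 7 3 8 (1 / 2) ∧
      BestBoundsTop 7 3 9 1 ∧
      BestBoundsTop 7 3 10 1 ∧
      BestBoundsTop 7 4 6 1 ∧
      BestBounds 7 6 8 0 (1 / 3) ∧
      BestBounds 7 6 9 0 (1 / 3) ∧
      BestBounds 7 6 10 0 (4 / 9) ∧
      BestBounds 7 8 9 1 2 ∧
      BestBounds 7 8 10 (4 / 3) 2 ∧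
      BestBounds 7 9 10 1 (4 / 3) ∧
      -- the remaining pairs, with the trivial bounds `0` and `∞` only
      BestBoundsTop 7 1 5 0 ∧
      BestBoundsTop 7 1 6 0 ∧
      BestBoundsTop 7 2 4 0 ∧
      BestBoundsTop 7 2 5 0 ∧
      BestBoundsTop 7 4 5 0 ∧
      BestBoundsTop 7 4 8 0 ∧
      BestBoundsTop 7 4 9 0 ∧
      BestBoundsTop 7 4 10 0 ∧
      BestBoundsTop 7 5 6 0 ∧
      BestBoundsTop 7 5 8 0 ∧
      BestBoundsTop 7 5 9 0 ∧
      BestBoundsTop 7 5 10 0 := by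
  obtain ⟨k, hk9, hroot, hk, hmax⟩ := exists_greatest_ratio
  obtain ⟨hC, hC'⟩ := isGreatest_sqrt hk9 hroot
  exact ⟨√k, hC, hC', bestBounds_1_2, bestBounds_1_3, bestBounds_1_4, bestBounds_1_8,
    bestBounds_1_9, bestBounds_1_10, bestBounds_2_3, bestBounds_2_6, bestBounds_2_8,
    ⟨bestBounds_2_9, centerDist_two_eq⟩, bestBounds_2_10, bestBounds_3_4, bestBounds_3_5,
    bestBounds_3_6 hk9 hk hmax, bestBounds_3_8, bestBounds_3_9, bestBounds_3_10, bestBounds_4_6,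
    bestBounds_6_8, bestBounds_6_9, bestBounds_6_10, bestBounds_8_9, bestBounds_8_10,
    bestBounds_9_10, bestBounds_1_5, bestBounds_1_6, bestBounds_2_4, bestBounds_2_5,
    bestBounds_4_5, bestBounds_4_8, bestBounds_4_9, bestBounds_4_10, bestBounds_5_6,
    bestBounds_5_8, bestBounds_5_9, bestBounds_5_10⟩
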